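/- Let $n\ge 1$, $m\ge 0$, $A\in\mathbb R^{n\times n}$, $B\in\mathbb R^{n\times m}$, $C\in\mathbb R^{m\times n}$, $D\in\mathbb R^{m\times m}$ with $\|D\|<1$ (spectral norm), and put $N=n2^m$. For $\mathcal J\subseteq\{1,\dots,m\}$ let $F_{\mathcal J}\in\mathbb R^{m\times m}$ be the matrix whose principal submatrix indexed by $\mathcal J$ is $(I-D_{\mathcal J\times\mathcal J})^{-1}$ and whose other entries are zero. Put $A_{\mathcal J}=A+BF_{\mathcal J}C$ and $T_{\mathcal J}=\begin{pmatrix} I\\ F_{\mathcal J}C\end{pmatrix}\in\mathbb R^{(n+m)\times n}$. Let $\Lambda_{\mathcal J}\subset\mathbb C$ be the set of eigenvalues of $A_{\mathcal J}$, and let $\mathcal V_{\mathcal J}\subset\mathbb C^n$ be the set of its unit eigenvectors, i.e. of the eigenvectors $v$ of $A_{\mathcal J}$ for which $y=T_{\mathcal J}v$ satisfies $\sum_{k=1}^{n+m}y_k^2=1$ (squares, not squared moduli). The tuple $(A,B,C,D)$ is called generic if 1. for every $\mathcal J$, the matrix $A_{\mathcal J}$ has $n$ distinct nonzero complex eigenvalues,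 and exactly two elements of $\mathcal V_{\mathcal J}$ belong to each of them; 2. $\bigcup_{\mathcal J}\Lambda_{\mathcal J}$ has $N$ distinct elements; 3. $\bigcup_{\mathcal J}\{T_{\mathcal J}v : v\in\mathcal V_{\mathcal J}\}$ has $2N$ distinct elements, all with nonzero first coordinate. Let $I\subset\mathbb R[x_1,\dots,x_n,w_1,\dots,w_m,\lambda]$ be the ideal generated by the entries of $Ax+Bw-\lambda x$, the polynomials $w_j(Cx+Dw)_j-w_j^2$ ($1\le j\le m$), and $\sum_{i=1}^n x_i^2+\sum_{j=1}^m w_j^2-1$, and let $V_{\mathbb C}(I)\subset\mathbb C^{n+m+1}$ be its complex variety. Proposition. If $(A,B,C,D)$ is generic, then $I$ is zero-dimensional (that is, $V_{\mathbb C}(I)$ is finite) and radical, and its reduced Gröbner basis with respect to the lexicographic order with $\lambda<x_1<\dots<x_n<w_1<\dots<w_m$ has the form $$\{u_0,\; x_1^2-u_1,\; x_2-u_2x_1,\dots,x_n-u_nx_1,\; w_1-v_1x_1,\dots,w_m-v_mx_1\},$$ where $u_i,v_j\in\mathbb R[\lambda]$ and $\deg u_0=\tfrac12\,\#V_{\mathbb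 C}(I)=N$. -/

import Mathlib

open scoped MonomialOrder

namespace ReLU

/-! ### Polynomial variables and the lexicographic order -/

/-- The variables `λ`, `x_1, …, x_n`, `w_1, …, w_m` (the indices start at `0` here). -/
inductive PVar (n m : ℕ) : Type
  | lam : PVar n m
  | x : Fin n → PVar n m
  | w : Fin m → PVar n m

/-- The position of a variable in the list `w_m, …, w_1, x_n, …, x_1, λ`. -/
def PVar.pos {n m : ℕ} : PVar n m → ℕ
  | .w j => m - 1 - (j : ℕ)
  | .x i => m + (n - 1 - (i : ℕ))
  | .lam => m + n

theorem PVar.pos_injective {n m : ℕ} :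
    Function.Injective (PVar.pos : PVar n m → ℕ) := by
  rintro (_ | ⟨i, hi⟩ | ⟨i, hi⟩) (_ | ⟨j, hj⟩ | ⟨j, hj⟩) h <;>
    simp only [PVar.pos] at h <;>
    first
    | rfl
    | (exfalso; omega)
    | (congr 2; omega)

/-- The variables are listed from the lexicographically most significant one (`w_m`) to the least
significant one (`λ`).  In Mathlib's `MonomialOrder.lex` smaller indices are more significant, so
the resulting order of monomials has `λ < x_1 < ⋯ < x_n < w_1 < ⋯ < w_m`. -/
noncomputable instance PVar.instLinearOrder (n m : ℕ) : LinearOrder (PVar n m) :=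
  LinearOrder.lift' PVar.pos PVar.pos_injective

theorem PVar.pos_le {n m : ℕ} (a : PVar n m) : a.pos ≤ m + n := by
  rcases a with _ | ⟨i, hi⟩ | ⟨i, hi⟩ <;> simp only [PVar.pos] <;> omega

instance PVar.instFinite (n m : ℕ) : Finite (PVar n m) :=
  Finite.of_injective (fun a : PVar n m => (⟨a.pos, Nat.lt_succ_of_le a.pos_le⟩ : Fin (m + n + 1)))
    fun _ _ h => PVar.pos_injective (congrArg Fin.val h)

/-- The polynomial ring `ℝ[x, w, λ]`. -/
abbrev Poly (n m : ℕ) : Type := MvPolynomial (PVar n m) ℝ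

/-- The lexicographic order with `λ < x_1 < ⋯ < x_n < w_1 < ⋯ < w_m`. -/
noncomputable abbrev lexOrder (n m : ℕ) : MonomialOrder (PVar n m) := MonomialOrder.lex

/-- A univariate polynomial `u`, regarded as the polynomial `u(λ)` of `ℝ[x, w, λ]`. -/
noncomputable def inLam {n m : ℕ} (u : Polynomial ℝ) : Poly n m :=
  Polynomial.aeval (MvPolynomial.X PVar.lam : Poly n m) u

/-! ### Gröbner bases -/

/-- `G` is a finite subset of `I` such that the leading term of every nonzero element of `I` is
divisible by the leading term of some element of `G`. -/
def IsGroebnerBasis {σ : Type*} (mo : MonomialOrder σ) (I : Ideal (MvPolynomial σ ℝ))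
    (G : Set (MvPolynomial σ ℝ)) : Prop :=
  G.Finite ∧ G ⊆ (I : Set (MvPolynomial σ ℝ)) ∧
    ∀ f ∈ I, f ≠ 0 → ∃ g ∈ G, mo.leadingTerm g ∣ mo.leadingTerm f

/-- A Gröbner basis is reduced if all its elements are monic and no monomial of an element `g`
lies in the ideal generated by the leading terms of the other elements. -/
def IsReducedGroebnerBasis {σ : Type*} (mo : MonomialOrder σ) (I : Ideal (MvPolynomial σ ℝ))
    (G : Set (MvPolynomial σ ℝ)) : Prop :=
  IsGroebnerBasis mo I G ∧
    (∀ g ∈ G, mo.leadingCoeff g = 1) ∧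
    ∀ g ∈ G, ∀ a ∈ g.support,
      MvPolynomial.monomial a (1 : ℝ) ∉ Ideal.span (mo.leadingTerm '' (G \ {g}))

section System

variable {n m : ℕ}
  (A : Matrix (Fin n) (Fin n) ℝ) (B : Matrix (Fin n) (Fin m) ℝ)
  (C : Matrix (Fin m) (Fin n) ℝ) (D : Matrix (Fin m) (Fin m) ℝ)

/-! ### The ideal -/

/-- The polynomial `(A x + B w - λ x)_i`. -/
noncomputable def linearEq (i : Fin n) : Poly n m :=
  (∑ k, MvPolynomial.C (A i k) * MvPolynomial.X (PVar.x k)) +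
    (∑ k, MvPolynomial.C (B i k) * MvPolynomial.X (PVar.w k)) -
    MvPolynomial.X PVar.lam * MvPolynomial.X (PVar.x i)

/-- The polynomial `w_j (C x + D w)_j - w_j ^ 2`. -/
noncomputable def reluEq (j : Fin m) : Poly n m :=
  MvPolynomial.X (PVar.w j) *
      ((∑ k, MvPolynomial.C (C j k) * MvPolynomial.X (PVar.x k)) +
        ∑ k, MvPolynomial.C (D j k) * MvPolynomial.X (PVar.w k)) -
    MvPolynomial.X (PVar.w j) ^ 2

/-- The polynomial `∑ x_i ^ 2 + ∑ w_j ^ 2 - 1`. -/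
noncomputable def unitEq (n m : ℕ) : Poly n m :=
  (∑ i, MvPolynomial.X (PVar.x i) ^ 2) + (∑ j, MvPolynomial.X (PVar.w j) ^ 2) - 1

/-- The ideal of `ℝ[x, w, λ]` generated by all the equations. -/
noncomputable def systemIdeal : Ideal (Poly n m) :=
  Ideal.span (Set.range (linearEq A B) ∪ Set.range (reluEq C D) ∪ {unitEq n m})

/-! ### Genericity -/

/-- The `m × m` matrix whose principal submatrix indexed by `J` is `(1 - D_{J × J})⁻¹`, with zero
entries elsewhere. -/
noncomputable def activeInv (J : Finset (Fin m)) : Matrix (Fin m) (Fin m) ℝ :=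
  fun i j =>
    if h : i ∈ J ∧ j ∈ J then
      (1 - D.submatrix (Subtype.val : {k // k ∈ J} → Fin m) Subtype.val)⁻¹ ⟨i, h.1⟩ ⟨j, h.2⟩
    else 0

/-- `A + B F_J C`, as a complex matrix. -/
noncomputable def modeMatrix (J : Finset (Fin m)) : Matrix (Fin n) (Fin n) ℂ :=
  (A + B * activeInv D J * C).map Complex.ofReal

/-- The set `Λ_J` of complex eigenvalues of `A + B F_J C`. -/
def modeEigenvalues (J : Finset (Fin m)) : Set ℂ :=
  {μ | Module.End.HasEigenvalue (Matrix.toLin' (modeMatrix A B C D J)) μ}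

/-- The vector `T_J v = (v, F_J C v)` of `ℂ^(n+m)`; that is, `x = v` and `w = F_J C v`. -/
noncomputable def stack (J : Finset (Fin m)) (v : Fin n → ℂ) : Fin n ⊕ Fin m → ℂ :=
  Sum.elim v (((activeInv D J * C).map Complex.ofReal).mulVec v)

/-- The eigenvectors `v` of `A + B F_J C` for the eigenvalue `μ` that are normalized by the unit
norm equation `∑ x_i ^ 2 + ∑ w_j ^ 2 = 1` at `(x, w) = T_J v`.  There are squares and no absolute
values here, because the polynomial equation is solved over the complex numbers. -/
def unitEigenvectors (J : Finset (Fin m)) (μ : ℂ) : Set (Fin n → ℂ) :=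
  {v | Module.End.HasEigenvector (Matrix.toLin' (modeMatrix A B C D J)) μ v ∧
    ∑ k, stack C D J v k ^ 2 = 1}

/-- The union over `J` of the sets `{T_J v : v ∈ 𝒱_J}`, where `𝒱_J` is the set of all unit
eigenvectors of `A + B F_J C`. -/
def stackedEigenvectors : Set (Fin n ⊕ Fin m → ℂ) :=
  ⋃ J : Finset (Fin m), stack C D J '' ⋃ μ ∈ modeEigenvalues A B C D J,
    unitEigenvectors A B C D J μ

/-- Genericity of the tuple `(A, B, C, D)`, to be used when `‖D‖ < 1`. -/
structure IsGeneric [NeZero n] : Prop where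
  ncard_modeEigenvalues : ∀ J, (modeEigenvalues A B C D J).ncard = n
  zero_notMem : ∀ J, (0 : ℂ) ∉ modeEigenvalues A B C D J
  ncard_unitEigenvectors : ∀ J, ∀ μ ∈ modeEigenvalues A B C D J,
    (unitEigenvectors A B C D J μ).ncard = 2
  ncard_iUnion : (⋃ J, modeEigenvalues A B C D J).ncard = n * 2 ^ m
  ncard_stacked : (stackedEigenvectors A B C D).ncard = 2 * (n * 2 ^ m)
  first_ne_zero : ∀ y ∈ stackedEigenvectors A B C D, y (Sum.inl 0) ≠ 0

end System

/-- The set `{u_0, x_1² - u_1, x_2 - u_2 x_1, …, x_n - u_n x_1, w_1 - v_1 x_1, …, w_m - v_m x_1}`.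
Since indices start at `0`, the polynomials `u_1, …, u_n` are `u 0, …, u (n - 1)`. -/
noncomputable def shapeSet {n m : ℕ} [NeZero n] (u₀ : Polynomial ℝ) (u : Fin n → Polynomial ℝ)
    (v : Fin m → Polynomial ℝ) : Set (Poly n m) :=
  {inLam u₀, MvPolynomial.X (PVar.x 0) ^ 2 - inLam (u 0)} ∪
    {p | ∃ i : Fin n, i ≠ 0 ∧
      p = MvPolynomial.X (PVar.x i) - inLam (u i) * MvPolynomial.X (PVar.x 0)} ∪
    Set.range fun j : Fin m =>
      MvPolynomial.X (PVar.w j) - inLam (v j) * MvPolynomial.X (PVar.x 0)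

end ReLU

/-!
Fix a set `J` of active units, those with `w_j = (C x + D w)_j`, and put `w_j = 0` for `j ∉ J`.
The equations then become linear: as `‖D‖ < 1`, the matrix `1 - D_{J × J}` is invertible
(`isUnit_one_sub_submatrix`), `w = F_J C x` (`active_iff`), and `x` is an eigenvector of `A_J` for
`λ`. So the points of the variety are the pairs of an eigenvalue and a unit eigenvector of some
`A_J` (`IsSolution.mem_unitEigenvectors`, `isSolution_modePoint`). By genericity there are `2 N` of
them, and the `N` fibres of the variety over the `λ`-axis consist of two opposite points each.

The ideal is radical because the local rings of the complex scheme of solutions are all `ℂ`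
(`IsGeneric.isSolution_eq_algebraMap`). In such a local ring, for each `j` one of the factors `w_j`
and `(C x + D w)_j - w_j` is a unit, since otherwise two of the matrices `A_J` would share an
eigenvalue. So the equations are linear there as well and give `A_J x = λ x`. The characteristic
polynomial of `A_J` has simple roots and vanishes at `λ`, so `λ` is the complex eigenvalue; the
eigenspace is a line, so `x` is a multiple of the complex eigenvector; and the unit equation
determines the factor up to a sign, which the residue field fixes. Together with the
Nullstellensatz, and the descent of scalars from `ℂ` to `ℝ`, this shows that the ideal consists of
all real polynomials that vanish on the variety (`IsGeneric.mem_systemIdeal_iff`).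

The Gröbner basis follows from interpolation. The functions `x_1 ^ 2`, `x_i / x_1` and `w_j / x_1`
are constant on the fibres over the `λ`-axis and compatible with complex conjugation, so each is a
real polynomial in `λ` of degree less than `N` (`IsGeneric.exists_polynomial_in_lam`), and `u_0` is
the product of the characteristic polynomials of the `A_J`. The monomials that are divisible by none
of the leading monomials `λ ^ N`, `x_1 ^ 2`, `x_i`, `w_j` are `λ ^ k` and `λ ^ k x_1` with `k < N`.
A combination `P(λ) x_1 + Q(λ)` of them that vanishes at both points of every fibre is zero, so
none of these monomials is the leading monomial of an element of the ideal
(`IsGeneric.not_isStandard_degree`).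
-/

namespace ReLU

variable {n m : ℕ}

/-! ### Restricted inverses -/

/-- A fixed vector of `D_{J × J}`, extended by zero, is not shortened by `D`, so it is zero when
`‖D‖ < 1`. -/
theorem isUnit_one_sub_submatrix {D : Matrix (Fin m) (Fin m) ℝ}
    (hD : ‖Matrix.toEuclideanCLM (𝕜 := ℝ) D‖ < 1) (J : Finset (Fin m)) :
    IsUnit (1 - D.submatrix (Subtype.val : {k // k ∈ J} → Fin m) Subtype.val).det := by
  classical
  rw [isUnit_iff_ne_zero]
  intro h0
  obtain ⟨z, hz, hz0⟩ := Matrix.exists_mulVec_eq_zero_iff.mpr h0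
  have hfix : ∀ j : {k // k ∈ J}, z j = ∑ k : {k // k ∈ J}, D j k * z k := by
    intro j
    have := congrFun hz0 j
    rw [Matrix.sub_mulVec, Matrix.one_mulVec] at this
    simpa [Matrix.mulVec, dotProduct, sub_eq_zero] using this
  -- The extension of `z` by zero.
  let y : Fin m → ℝ := fun k => if h : k ∈ J then z ⟨k, h⟩ else 0
  have hy : ∀ k : {k // k ∈ J}, y k = z k := fun k => by simp [y]
  have hDy : ∀ j : {k // k ∈ J}, (D.mulVec y) j = z j := by
    intro j
    rw [hfix j, Matrix.mulVec, dotProduct]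
    rw [← Finset.sum_subset (Finset.subset_univ J)
      (fun k _ hk => by simp [y, hk]), ← Finset.sum_coe_sort]
    exact Finset.sum_congr rfl fun k _ => by rw [hy]
  have hypos : 0 < ‖WithLp.toLp 2 y‖ := by
    rw [norm_pos_iff]
    intro h
    refine hz (funext fun k => ?_)
    rw [← hy]
    have := congrArg (fun u : EuclideanSpace ℝ (Fin m) => u k) h
    simpa using this
  have hle : ‖WithLp.toLp 2 y‖ ≤ ‖Matrix.toEuclideanCLM (𝕜 := ℝ) D (WithLp.toLp 2 y)‖ := by
    rw [Matrix.toEuclideanCLM_toLp, EuclideanSpace.norm_eq, EuclideanSpace.norm_eq]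
    refine Real.sqrt_le_sqrt (Finset.sum_le_sum fun k _ => ?_)
    by_cases hk : k ∈ J
    · have h1 := hDy ⟨k, hk⟩
      have h2 := hy ⟨k, hk⟩
      simp only at h1 h2
      simp [h1, h2]
    · have hk0 : y k = 0 := by simp [y, hk]
      simpa [hk0] using sq_nonneg _
  have := (Matrix.toEuclideanCLM (𝕜 := ℝ) D).le_opNorm (WithLp.toLp 2 y)
  nlinarith

theorem activeInv_eq_zero_left (D : Matrix (Fin m) (Fin m) ℝ) {J : Finset (Fin m)} {i : Fin m}
    (hi : i ∉ J) (j : Fin m) : activeInv D J i j = 0 := by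
  simp [activeInv, hi]

theorem activeInv_eq_zero_right (D : Matrix (Fin m) (Fin m) ℝ) {J : Finset (Fin m)} (i : Fin m)
    {j : Fin m} (hj : j ∉ J) : activeInv D J i j = 0 := by
  simp [activeInv, hj]

theorem sum_activeInv_mul_one_sub {D : Matrix (Fin m) (Fin m) ℝ} {J : Finset (Fin m)}
    (hJ : IsUnit (1 - D.submatrix (Subtype.val : {k // k ∈ J} → Fin m) Subtype.val).det)
    {i j : Fin m} (hi : i ∈ J) (hj : j ∈ J) :
    ∑ k, activeInv D J i k * (1 - D) k j = (1 : Matrix (Fin m) (Fin m) ℝ) i j := by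
  have h := congrFun (congrFun (Matrix.nonsing_inv_mul _ hJ) ⟨i, hi⟩) ⟨j, hj⟩
  rw [Matrix.mul_apply] at h
  rw [← Finset.sum_subset (Finset.subset_univ J)
    (fun k _ hk => by rw [activeInv_eq_zero_right D i hk, zero_mul]), ← Finset.sum_coe_sort]
  refine Eq.trans (Finset.sum_congr rfl fun k _ => ?_) (h.trans ?_)
  · simp [activeInv, hi, Matrix.one_apply, Subtype.ext_iff]
  · simp [Matrix.one_apply]

theorem sum_one_sub_mul_activeInv {D : Matrix (Fin m) (Fin m) ℝ} {J : Finset (Fin m)}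
    (hJ : IsUnit (1 - D.submatrix (Subtype.val : {k // k ∈ J} → Fin m) Subtype.val).det)
    {i j : Fin m} (hi : i ∈ J) (hj : j ∈ J) :
    ∑ k, (1 - D) i k * activeInv D J k j = (1 : Matrix (Fin m) (Fin m) ℝ) i j := by
  have h := congrFun (congrFun (Matrix.mul_nonsing_inv _ hJ) ⟨i, hi⟩) ⟨j, hj⟩
  rw [Matrix.mul_apply] at h
  rw [← Finset.sum_subset (Finset.subset_univ J)
    (fun k _ hk => by rw [activeInv_eq_zero_left D hk, mul_zero]), ← Finset.sum_coe_sort]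
  refine Eq.trans (Finset.sum_congr rfl fun k _ => ?_) (h.trans ?_)
  · simp [activeInv, hj, Matrix.one_apply, Subtype.ext_iff]
  · simp [Matrix.one_apply]

/-- Once the set `J` of active units is fixed, the equations `w_j = (z + D w)_j` for `j ∈ J` and
`w_j = 0` for `j ∉ J` are linear, and their unique solution is `w = F_J z`. The coordinates may
lie in any real algebra. -/
theorem active_iff {L : Type*} [CommRing L] [Algebra ℝ L] {D : Matrix (Fin m) (Fin m) ℝ}
    {J : Finset (Fin m)}
    (hJ : IsUnit (1 - D.submatrix (Subtype.val : {k // k ∈ J} → Fin m) Subtype.val).det)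
    (z w : Fin m → L) :
    ((∀ j ∈ J, w j = z j + ∑ k, D j k • w k) ∧ ∀ j ∉ J, w j = 0) ↔
      ∀ j, w j = ∑ k, activeInv D J j k • z k := by
  have one_sub : ∀ (w : Fin m → L) j, ∑ k, (1 - D) j k • w k = w j - ∑ k, D j k • w k := by
    intro w j
    simp [sub_smul, Finset.sum_sub_distrib, Matrix.one_apply]
  constructor
  · rintro ⟨h1, h0⟩ i
    by_cases hi : i ∈ J
    · have hz : ∀ k, activeInv D J i k • z k
          = activeInv D J i k • ∑ l, (1 - D) k l • w l := by
        intro k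
        by_cases hk : k ∈ J
        · rw [one_sub, eq_sub_of_add_eq (h1 k hk).symm]
        · simp [activeInv_eq_zero_right D i hk]
      rw [Finset.sum_congr rfl fun k _ => hz k]
      simp only [Finset.smul_sum, smul_smul]
      rw [Finset.sum_comm]
      simp only [← Finset.sum_smul]
      have : ∀ l, (∑ k, activeInv D J i k * (1 - D) k l) • w l
          = (1 : Matrix (Fin m) (Fin m) ℝ) i l • w l := by
        intro l
        by_cases hl : l ∈ J
        · rw [sum_activeInv_mul_one_sub hJ hi hl]
        · simp [h0 l hl]
      rw [Finset.sum_congr rfl fun l _ => this l]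
      simp [Matrix.one_apply]
    · simp [h0 i hi, activeInv_eq_zero_left D hi]
  · intro h
    refine ⟨fun i hi => ?_, fun i hi => by simp [h i, activeInv_eq_zero_left D hi]⟩
    rw [← sub_eq_iff_eq_add, ← one_sub]
    have hw : ∀ k, (1 - D) i k • w k = (1 - D) i k • ∑ l, activeInv D J k l • z l := by
      intro k; rw [h k]
    rw [Finset.sum_congr rfl fun k _ => hw k]
    simp only [Finset.smul_sum, smul_smul]
    rw [Finset.sum_comm]
    simp only [← Finset.sum_smul]
    have : ∀ l, (∑ k, (1 - D) i k * activeInv D J k l) • z l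
        = (1 : Matrix (Fin m) (Fin m) ℝ) i l • z l := by
      intro l
      by_cases hl : l ∈ J
      · rw [sum_one_sub_mul_activeInv hJ hi hl]
      · have hil : i ≠ l := fun h => hl (h ▸ hi)
        simp [activeInv_eq_zero_right D _ hl, Matrix.one_apply, hil]
    rw [Finset.sum_congr rfl fun l _ => this l]
    simp [Matrix.one_apply]

/-! ### Solutions with coordinates in a real algebra -/

section Solutions

variable (A : Matrix (Fin n) (Fin n) ℝ) (B : Matrix (Fin n) (Fin m) ℝ)
  (C : Matrix (Fin m) (Fin n) ℝ) (D : Matrix (Fin m) (Fin m) ℝ)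

/-- The values `y` of the variables in a real algebra solve the system. -/
structure IsSolution {L : Type*} [CommRing L] [Algebra ℝ L] (y : PVar n m → L) : Prop where
  linear : ∀ i, ∑ k, A i k • y (.x k) + ∑ k, B i k • y (.w k) = y .lam * y (.x i)
  relu : ∀ j, y (.w j) * (∑ k, C j k • y (.x k) + ∑ k, D j k • y (.w k) - y (.w j)) = 0
  unit : ∑ i, y (.x i) ^ 2 + ∑ j, y (.w j) ^ 2 = 1

/-- The real matrix `A + B F_J C`. -/
noncomputable def realMode (J : Finset (Fin m)) : Matrix (Fin n) (Fin n) ℝ :=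
  A + B * activeInv D J * C

variable {A B C D}

theorem isSolution_iff {L : Type*} [CommRing L] [Algebra ℝ L] (y : PVar n m → L) :
    IsSolution A B C D y ↔ ∀ f ∈ systemIdeal A B C D, MvPolynomial.aeval y f = 0 := by
  have h1 : ∀ i, MvPolynomial.aeval y (linearEq A B i) =
      ∑ k, A i k • y (.x k) + ∑ k, B i k • y (.w k) - y .lam * y (.x i) := by
    intro i; simp [linearEq, Algebra.smul_def]
  have h2 : ∀ j, MvPolynomial.aeval y (reluEq C D j) =
      y (.w j) * (∑ k, C j k • y (.x k) + ∑ k, D j k • y (.w k) - y (.w j)) := by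
    intro j; simp [reluEq, Algebra.smul_def]; ring
  have h3 : MvPolynomial.aeval y (unitEq n m) =
      ∑ i, y (.x i) ^ 2 + ∑ j, y (.w j) ^ 2 - 1 := by
    simp [unitEq]
  constructor
  · intro h
    suffices systemIdeal A B C D ≤ RingHom.ker (MvPolynomial.aeval (R := ℝ) y) from
      fun f hf => this hf
    refine Ideal.span_le.mpr ?_
    rintro f ((⟨i, rfl⟩ | ⟨j, rfl⟩) | rfl)
    · exact (h1 i).trans (sub_eq_zero.mpr (h.linear i))
    · exact (h2 j).trans (h.relu j)
    · exact h3.trans (sub_eq_zero.mpr h.unit)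
  · intro h
    refine ⟨fun i => ?_, fun j => ?_, ?_⟩
    · rw [← sub_eq_zero, ← h1]
      exact h _ (Ideal.subset_span (Or.inl (Or.inl ⟨i, rfl⟩)))
    · rw [← h2]
      exact h _ (Ideal.subset_span (Or.inl (Or.inr ⟨j, rfl⟩)))
    · rw [← sub_eq_zero, ← h3]
      exact h _ (Ideal.subset_span (Or.inr rfl))

theorem sum_add_sum_eq_realMode {L : Type*} [CommRing L] [Algebra ℝ L] (J : Finset (Fin m))
    {x : Fin n → L} {w : Fin m → L} (hw : ∀ j, w j = ∑ k, (activeInv D J * C) j k • x k)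
    (i : Fin n) :
    ∑ k, A i k • x k + ∑ k, B i k • w k = ∑ k, realMode A B C D J i k • x k := by
  simp only [hw, realMode, Matrix.add_apply, add_smul, Finset.sum_add_distrib, Finset.smul_sum,
    smul_smul]
  rw [Finset.sum_comm, Matrix.mul_assoc]
  simp only [Matrix.mul_apply (M := B), Finset.sum_smul]

theorem sum_activeInv_smul_sum {L : Type*} [CommRing L] [Algebra ℝ L] (J : Finset (Fin m))
    (x : Fin n → L) (j : Fin m) :
    ∑ k, activeInv D J j k • ∑ l, C k l • x l = ∑ k, (activeInv D J * C) j k • x k := by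
  simp only [Finset.smul_sum, smul_smul]
  rw [Finset.sum_comm]
  simp only [Matrix.mul_apply, Finset.sum_smul]

end Solutions

/-! ### Complex solutions and unit eigenvectors -/

section Complex

variable {A : Matrix (Fin n) (Fin n) ℝ} {B : Matrix (Fin n) (Fin m) ℝ}
  {C : Matrix (Fin m) (Fin n) ℝ} {D : Matrix (Fin m) (Fin m) ℝ}

theorem mem_zeroLocus_iff_isSolution {p : PVar n m → ℂ} :
    p ∈ MvPolynomial.zeroLocus ℂ (systemIdeal A B C D) ↔ IsSolution A B C D p := by
  rw [isSolution_iff]; rfl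

theorem IsSolution.map {L L' : Type*} [CommRing L] [Algebra ℝ L] [CommRing L'] [Algebra ℝ L']
    {y : PVar n m → L} (hy : IsSolution A B C D y) (φ : L →ₐ[ℝ] L') :
    IsSolution A B C D (fun a => φ (y a)) := by
  rw [isSolution_iff] at hy ⊢
  intro f hf
  have := congrArg φ (hy f hf)
  rwa [map_zero, ← AlgHom.comp_apply, MvPolynomial.comp_aeval] at this

theorem modeMatrix_mulVec (J : Finset (Fin m)) (v : Fin n → ℂ) (i : Fin n) :
    (modeMatrix A B C D J).mulVec v i = ∑ k, realMode A B C D J i k • v k := by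
  simp [modeMatrix, realMode, Matrix.mulVec, dotProduct]

theorem stack_inl (J : Finset (Fin m)) (v : Fin n → ℂ) (i : Fin n) :
    stack C D J v (Sum.inl i) = v i := rfl

theorem stack_inr (J : Finset (Fin m)) (v : Fin n → ℂ) (j : Fin m) :
    stack C D J v (Sum.inr j) = ∑ k, (activeInv D J * C) j k • v k := by
  simp [stack, Matrix.mulVec, dotProduct]

theorem stack_add (J : Finset (Fin m)) (u v : Fin n → ℂ) :
    stack C D J (u + v) = stack C D J u + stack C D J v := by
  funext k
  rcases k with k | k
  · rfl
  · simp [stack_inr, smul_add, Finset.sum_add_distrib]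

theorem stack_smul (J : Finset (Fin m)) (c : ℂ) (v : Fin n → ℂ) :
    stack C D J (c • v) = c • stack C D J v := by
  funext k
  rcases k with k | k
  · rfl
  · simp [stack_inr, Finset.mul_sum, mul_left_comm]

theorem mem_unitEigenvectors_iff {J : Finset (Fin m)} {μ : ℂ} {v : Fin n → ℂ} :
    v ∈ unitEigenvectors A B C D J μ ↔
      (modeMatrix A B C D J).mulVec v = μ • v ∧ ∑ k, stack C D J v k ^ 2 = 1 := by
  refine ⟨fun h => ⟨?_, h.2⟩, fun h => ⟨?_, h.2⟩⟩
  · simpa using h.1.apply_eq_smul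
  · rw [Module.End.hasEigenvector_iff, Module.End.mem_eigenspace_iff]
    refine ⟨by simpa using h.1, ?_⟩
    rintro rfl
    have h0 : stack C D J 0 = 0 := by simpa using stack_smul (C := C) (D := D) J 0 0
    simp [h0] at h

theorem mem_modeEigenvalues_of_mem {J : Finset (Fin m)} {μ : ℂ} {v : Fin n → ℂ}
    (hv : v ∈ unitEigenvectors A B C D J μ) : μ ∈ modeEigenvalues A B C D J :=
  Module.End.hasEigenvalue_of_hasEigenvector hv.1

theorem stack_mem_stackedEigenvectors {J : Finset (Fin m)} {μ : ℂ} {v : Fin n → ℂ}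
    (hv : v ∈ unitEigenvectors A B C D J μ) :
    stack C D J v ∈ stackedEigenvectors A B C D :=
  Set.mem_iUnion.mpr ⟨J, v, Set.mem_iUnion₂.mpr ⟨μ, mem_modeEigenvalues_of_mem hv, hv⟩, rfl⟩

theorem neg_mem_unitEigenvectors {J : Finset (Fin m)} {μ : ℂ} {v : Fin n → ℂ}
    (hv : v ∈ unitEigenvectors A B C D J μ) : -v ∈ unitEigenvectors A B C D J μ := by
  rw [mem_unitEigenvectors_iff] at hv ⊢
  rw [← neg_one_smul ℂ v, stack_smul]
  refine ⟨?_, by simpa using hv.2⟩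
  rw [Matrix.mulVec_smul, hv.1, smul_comm]

/-- A solution comes from the set `J` of active units whenever `w_j = 0` for `j ∉ J` and
`w_j = (C x + D w)_j` for `j ∈ J`. -/
theorem IsSolution.mem_unitEigenvectors (hD : ‖Matrix.toEuclideanCLM (𝕜 := ℝ) D‖ < 1)
    {p : PVar n m → ℂ} (hp : IsSolution A B C D p) {J : Finset (Fin m)}
    (h0 : ∀ j ∉ J, p (.w j) = 0)
    (h1 : ∀ j ∈ J, p (.w j) = ∑ k, C j k • p (.x k) + ∑ k, D j k • p (.w k)) :
    (fun i => p (.x i)) ∈ unitEigenvectors A B C D J (p .lam) ∧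
      ∀ j, p (.w j) = ∑ k, (activeInv D J * C) j k • p (.x k) := by
  have hw : ∀ j, p (.w j) = ∑ k, (activeInv D J * C) j k • p (.x k) := by
    intro j
    rw [← sum_activeInv_smul_sum]
    exact (active_iff (isUnit_one_sub_submatrix hD J) (fun j => ∑ k, C j k • p (.x k))
      (fun j => p (.w j))).mp ⟨h1, h0⟩ j
  refine ⟨mem_unitEigenvectors_iff.mpr ⟨?_, ?_⟩, hw⟩
  · funext i
    rw [modeMatrix_mulVec, ← sum_add_sum_eq_realMode J hw i, hp.linear i]
    rfl
  · rw [Fintype.sum_sum_type, ← hp.unit]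
    simp only [stack_inl, stack_inr, ← hw]

theorem IsSolution.exists_mode (hD : ‖Matrix.toEuclideanCLM (𝕜 := ℝ) D‖ < 1)
    {p : PVar n m → ℂ} (hp : IsSolution A B C D p) :
    ∃ J, (fun i => p (.x i)) ∈ unitEigenvectors A B C D J (p .lam) ∧
      ∀ j, p (.w j) = ∑ k, (activeInv D J * C) j k • p (.x k) := by
  classical
  refine ⟨Finset.univ.filter fun j => p (.w j) ≠ 0, hp.mem_unitEigenvectors hD ?_ ?_⟩
  · intro j hj
    simpa using hj
  · intro j hj
    have hj : p (.w j) ≠ 0 := by simpa using hj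
    exact (sub_eq_zero.mp ((mul_eq_zero.mp (hp.relu j)).resolve_left hj)).symm

/-- The values of the variables at the solution given by an eigenvalue and an eigenvector. -/
noncomputable def modePoint (C : Matrix (Fin m) (Fin n) ℝ) (D : Matrix (Fin m) (Fin m) ℝ)
    (J : Finset (Fin m)) (μ : ℂ) (v : Fin n → ℂ) : PVar n m → ℂ
  | .lam => μ
  | .x i => v i
  | .w j => ∑ k, (activeInv D J * C) j k • v k

theorem isSolution_modePoint (hD : ‖Matrix.toEuclideanCLM (𝕜 := ℝ) D‖ < 1)
    {J : Finset (Fin m)} {μ : ℂ} {v : Fin n → ℂ} (hv : v ∈ unitEigenvectors A B C D J μ) :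
    IsSolution A B C D (modePoint C D J μ v) := by
  rw [mem_unitEigenvectors_iff] at hv
  have hw : ∀ j, modePoint C D J μ v (.w j) =
      ∑ k, (activeInv D J * C) j k • modePoint C D J μ v (.x k) := fun j => rfl
  refine ⟨fun i => ?_, fun j => ?_, ?_⟩
  · rw [sum_add_sum_eq_realMode J hw]
    have := congrFun hv.1 i
    rwa [modeMatrix_mulVec] at this
  · have h := (active_iff (isUnit_one_sub_submatrix hD J)
      (fun j => ∑ k, C j k • modePoint C D J μ v (.x k))
      (fun j => modePoint C D J μ v (.w j))).mpr
      fun j => (hw j).trans (sum_activeInv_smul_sum _ _ _).symm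
    by_cases hj : j ∈ J
    · rw [← h.1 j hj, sub_self, mul_zero]
    · rw [h.2 j hj, zero_mul]
  · rw [← hv.2, Fintype.sum_sum_type]
    simp only [stack_inl, stack_inr]
    rfl

end Complex

/-! ### Consequences of genericity -/

section Generic

variable [NeZero n] {A : Matrix (Fin n) (Fin n) ℝ} {B : Matrix (Fin n) (Fin m) ℝ}
  {C : Matrix (Fin m) (Fin n) ℝ} {D : Matrix (Fin m) (Fin m) ℝ}

theorem IsGeneric.finite_modeEigenvalues (hg : IsGeneric A B C D) (J : Finset (Fin m)) :
    (modeEigenvalues A B C D J).Finite :=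
  Set.finite_of_ncard_ne_zero (by rw [hg.ncard_modeEigenvalues J]; exact NeZero.ne n)

/-- The `2 ^ m` sets `Λ_J` have `n` elements each and `n * 2 ^ m` together, so they are
disjoint. -/
theorem IsGeneric.eq_of_mem (hg : IsGeneric A B C D) {J K : Finset (Fin m)} {μ : ℂ}
    (hJ : μ ∈ modeEigenvalues A B C D J) (hK : μ ∈ modeEigenvalues A B C D K) : J = K := by
  classical
  by_contra hne
  let S : Finset (Fin m) → Finset ℂ := fun J => (hg.finite_modeEigenvalues J).toFinset
  have hS : ∀ J, (S J).card = n := fun J => by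
    rw [← Set.ncard_eq_toFinset_card _ (hg.finite_modeEigenvalues J), hg.ncard_modeEigenvalues]
  have hU : (Finset.univ.biUnion S).card = n * 2 ^ m := by
    rw [← hg.ncard_iUnion, ← Set.ncard_coe_finset]
    congr 1
    ext z
    simp [S]
  -- If `μ` also lies in `Λ_K`, it can be erased from `Λ_J` without changing the union, which is
  -- then too small.
  have hsub : Finset.univ.biUnion S ⊆
      Finset.univ.biUnion (Function.update S J ((S J).erase μ)) := by
    intro z hz
    obtain ⟨I, -, hI⟩ := Finset.mem_biUnion.mp hz
    rw [Finset.mem_biUnion]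
    by_cases hIJ : I = J
    · subst hIJ
      by_cases hzμ : z = μ
      · refine ⟨K, Finset.mem_univ _, ?_⟩
        rw [Function.update_of_ne (Ne.symm hne), hzμ]
        simpa [S] using hK
      · exact ⟨I, Finset.mem_univ _, by simp [hzμ, hI]⟩
    · exact ⟨I, Finset.mem_univ _, by rwa [Function.update_of_ne hIJ]⟩
  have hlt : ∑ I, (Function.update S J ((S J).erase μ) I).card < ∑ I, (S I).card := by
    refine Finset.sum_lt_sum (fun I _ => ?_) ⟨J, Finset.mem_univ _, ?_⟩
    · by_cases hIJ : I = J
      · subst hIJ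
        simpa using Finset.card_le_card (Finset.erase_subset μ (S I))
      · rw [Function.update_of_ne hIJ]
    · rw [Function.update_self]
      exact Finset.card_erase_lt_of_mem (by simpa [S] using hJ)
  have h1 := (Finset.card_le_card hsub).trans Finset.card_biUnion_le
  have h2 : ∑ I : Finset (Fin m), (S I).card = n * 2 ^ m := by
    simp [hS, mul_comm]
  omega

theorem IsGeneric.first_ne_zero' (hg : IsGeneric A B C D) {J : Finset (Fin m)} {μ : ℂ}
    {v : Fin n → ℂ} (hv : v ∈ unitEigenvectors A B C D J μ) : v 0 ≠ 0 :=
  hg.first_ne_zero _ (stack_mem_stackedEigenvectors hv)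

theorem IsGeneric.eq_or_eq_neg (hg : IsGeneric A B C D) {J : Finset (Fin m)} {μ : ℂ}
    {u v : Fin n → ℂ} (hu : u ∈ unitEigenvectors A B C D J μ)
    (hv : v ∈ unitEigenvectors A B C D J μ) : u = v ∨ u = -v := by
  obtain ⟨a, b, hab, hS⟩ := Set.ncard_eq_two.mp
    (hg.ncard_unitEigenvectors J μ (mem_modeEigenvalues_of_mem hv))
  have hne : v ≠ -v := by
    intro h
    refine hg.first_ne_zero' hv ?_
    have := congrFun h 0
    simpa [self_eq_neg] using this
  have hv' := neg_mem_unitEigenvectors hv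
  rw [hS] at hu hv hv'
  simp only [Set.mem_insert_iff, Set.mem_singleton_iff] at hu hv hv'
  grind

/-- If the eigenspace of `μ` had dimension at least two, it would contain unit eigenvectors
besides `v` and `-v`. -/
theorem IsGeneric.eq_smul_of_mulVec_eq (hg : IsGeneric A B C D) {J : Finset (Fin m)} {μ : ℂ}
    {u v : Fin n → ℂ} (hv : v ∈ unitEigenvectors A B C D J μ)
    (hu : (modeMatrix A B C D J).mulVec u = μ • u) : u = (u 0 / v 0) • v := by
  have hv0 := hg.first_ne_zero' hv
  have hv' := mem_unitEigenvectors_iff.mp hv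
  set r := u - (u 0 / v 0) • v with hr
  have hr0 : r 0 = 0 := by simp [hr, hv0]
  have hMr : (modeMatrix A B C D J).mulVec r = μ • r := by
    rw [hr, Matrix.mulVec_sub, Matrix.mulVec_smul, hu, hv'.1, smul_sub, smul_comm]
  suffices r = 0 from sub_eq_zero.mp this
  set b := ∑ k, stack C D J v k * stack C D J r k
  set c := ∑ k, stack C D J r k ^ 2
  have hq : ∀ t : ℂ, ∑ k, stack C D J (v + t • r) k ^ 2 = 1 + 2 * t * b + t ^ 2 * c := by
    intro t
    rw [stack_add, stack_smul, ← hv'.2, Finset.mul_sum, Finset.mul_sum,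
      ← Finset.sum_add_distrib, ← Finset.sum_add_distrib]
    refine Finset.sum_congr rfl fun k _ => ?_
    simp only [Pi.add_apply, Pi.smul_apply, smul_eq_mul]
    ring
  -- The quadratic polynomial `1 + 2 b t + c t²` cannot vanish at all of `1`, `-1`, `2`.
  obtain ⟨t, ht, hqt⟩ : ∃ t : ℂ, t ≠ 0 ∧ 1 + 2 * t * b + t ^ 2 * c ≠ 0 := by
    by_contra! h
    have h1 := h 1 one_ne_zero
    have h2 := h (-1) (by norm_num)
    have h3 := h 2 two_ne_zero
    have : (1 : ℂ) = 0 := by linear_combination h1 + (1 / 3) * h2 - (1 / 3) * h3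
    exact one_ne_zero this
  obtain ⟨s, hs⟩ := IsAlgClosed.exists_eq_mul_self (1 + 2 * t * b + t ^ 2 * c)
  have hs0 : s ≠ 0 := by
    rintro rfl
    exact hqt (by simpa using hs)
  have hmem : s⁻¹ • (v + t • r) ∈ unitEigenvectors A B C D J μ := by
    rw [mem_unitEigenvectors_iff]
    constructor
    · rw [Matrix.mulVec_smul, Matrix.mulVec_add, Matrix.mulVec_smul, hv'.1, hMr,
        smul_comm t, ← smul_add, smul_comm]
    · rw [stack_smul]
      simp only [Pi.smul_apply, smul_eq_mul, mul_pow]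
      rw [← Finset.mul_sum, hq, hs]
      field_simp
  obtain ⟨e, he⟩ : ∃ e : ℂ, s⁻¹ • (v + t • r) = e • v := by
    rcases hg.eq_or_eq_neg hmem hv with h | h
    · exact ⟨1, by rw [h, one_smul]⟩
    · exact ⟨-1, by rw [h, neg_one_smul]⟩
  have he0 : s⁻¹ = e := by
    have := congrFun he 0
    simpa [hr0, hv0] using this
  rw [← he0] at he
  have := smul_right_injective _ (inv_ne_zero hs0) he
  simpa [ht] using this

end Generic

/-! ### Solutions over local complex algebras -/

section Rigidity

variable {A : Matrix (Fin n) (Fin n) ℝ} {B : Matrix (Fin n) (Fin m) ℝ}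
  {C : Matrix (Fin m) (Fin n) ℝ} {D : Matrix (Fin m) (Fin m) ℝ}

theorem charpoly_modeMatrix (J : Finset (Fin m)) :
    (modeMatrix A B C D J).charpoly = (realMode A B C D J).charpoly.map (algebraMap ℝ ℂ) :=
  Matrix.charpoly_map _ (algebraMap ℝ ℂ)

theorem mem_modeEigenvalues_iff_isRoot {J : Finset (Fin m)} {μ : ℂ} :
    μ ∈ modeEigenvalues A B C D J ↔ (modeMatrix A B C D J).charpoly.IsRoot μ := by
  rw [← Matrix.charpoly_toLin', ← Module.End.hasEigenvalue_iff_isRoot_charpoly]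
  rfl

theorem IsGeneric.charpoly_eq_prod [NeZero n] (hg : IsGeneric A B C D) (J : Finset (Fin m)) :
    (modeMatrix A B C D J).charpoly =
      ∏ μ ∈ (hg.finite_modeEigenvalues J).toFinset, (Polynomial.X - Polynomial.C μ) := by
  classical
  set χ := (modeMatrix A B C D J).charpoly with hχ
  have hmonic : χ.Monic := Matrix.charpoly_monic _
  have hroots : χ.roots.toFinset = (hg.finite_modeEigenvalues J).toFinset := by
    ext μ
    simp [mem_modeEigenvalues_iff_isRoot, hmonic.ne_zero, ← hχ]
  have hcard : χ.roots.toFinset.card = n := by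
    rw [hroots, ← Set.ncard_eq_toFinset_card _ (hg.finite_modeEigenvalues J),
      hg.ncard_modeEigenvalues]
  have hdeg : χ.natDegree = n := by
    rw [hχ, Matrix.charpoly_natDegree_eq_dim, Fintype.card_fin]
  have hnodup : χ.roots.Nodup := by
    rw [← Multiset.toFinset_card_eq_card_iff_nodup]
    refine le_antisymm (Multiset.toFinset_card_le _) ?_
    rw [hcard, ← hdeg]
    exact Polynomial.card_roots' _
  have hsplit := (IsAlgClosed.splits χ).eq_prod_roots_of_monic hmonic
  rw [← hroots, Finset.prod, Multiset.toFinset_val, hnodup.dedup]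
  exact hsplit

/-- A linear form that vanishes on the eigenspace `ℂ v` is a combination of the rows of
`A_J - μ`. -/
theorem IsGeneric.exists_row_combination [NeZero n] (hg : IsGeneric A B C D)
    {J : Finset (Fin m)} {μ : ℂ} {v : Fin n → ℂ} (hv : v ∈ unitEigenvectors A B C D J μ)
    (i : Fin n) :
    ∃ c : Fin n → ℂ, ∀ k, ∑ j, c j * (modeMatrix A B C D J - μ • 1) j k =
      (1 : Matrix (Fin n) (Fin n) ℂ) i k - v i / v 0 * (1 : Matrix (Fin n) (Fin n) ℂ) 0 k := by
  set M := modeMatrix A B C D J - μ • 1 with hM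
  let φ : Module.Dual ℂ (Fin n → ℂ) := LinearMap.proj i - (v i / v 0) • LinearMap.proj 0
  have hφ : φ ∈ LinearMap.range (Matrix.toLin' M).dualMap := by
    rw [LinearMap.range_dualMap_eq_dualAnnihilator_ker, Submodule.mem_dualAnnihilator]
    intro u hu
    have hu' : (modeMatrix A B C D J).mulVec u = μ • u := by
      rw [LinearMap.mem_ker, Matrix.toLin'_apply, hM, Matrix.sub_mulVec, Matrix.smul_mulVec,
        Matrix.one_mulVec] at hu
      exact sub_eq_zero.mp hu
    have := congrFun (hg.eq_smul_of_mulVec_eq hv hu') i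
    simp only [Pi.smul_apply, smul_eq_mul] at this
    simp only [φ, LinearMap.sub_apply, LinearMap.smul_apply, LinearMap.proj_apply, smul_eq_mul]
    rw [this]
    ring
  obtain ⟨ψ, hψ⟩ := hφ
  refine ⟨fun j => ψ (Pi.single j 1), fun k => ?_⟩
  have h := LinearMap.congr_fun hψ (Pi.single k 1)
  have hcol : M.mulVec (Pi.single k 1) = ∑ j, M j k • Pi.single j (1 : ℂ) := by
    funext l
    simp [Finset.sum_apply, Pi.single_apply]
  rw [LinearMap.dualMap_apply, Matrix.toLin'_apply, hcol, map_sum] at h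
  simp only [map_smul, smul_eq_mul] at h
  simp only [mul_comm (ψ _)]
  rw [h]
  simp [φ, Matrix.one_apply, Pi.single_apply]

/-- Over a commutative ring, `M x = t x` implies `χ_M(t) x = 0`: multiply `(t - M) x = 0` by the
adjugate of `t - M`. -/
theorem aeval_charpoly_mul_eq_zero {R L : Type*} [CommRing R] [CommRing L] [Algebra R L]
    (M : Matrix (Fin n) (Fin n) R) {t : L} {x : Fin n → L}
    (h : ∀ i, ∑ k, M i k • x k = t * x i) (i : Fin n) :
    Polynomial.aeval t M.charpoly * x i = 0 := by
  set N := Matrix.scalar (Fin n) t - M.map (algebraMap R L) with hN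
  have hx : N.mulVec x = 0 := by
    funext i
    rw [hN, Matrix.sub_mulVec, Pi.sub_apply, Pi.zero_apply, sub_eq_zero]
    simpa [Matrix.mulVec, dotProduct, Algebra.smul_def, Matrix.diagonal_apply] using (h i).symm
  have hdet : Polynomial.aeval t M.charpoly = N.det := by
    rw [hN, ← Matrix.eval_charpoly, Matrix.charpoly_map, Polynomial.eval_map_algebraMap]
  have := congrFun (congrArg (N.adjugate.mulVec) hx) i
  rw [Matrix.mulVec_mulVec, Matrix.adjugate_mul, Matrix.mulVec_zero, Matrix.smul_mulVec,
    Matrix.one_mulVec] at this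
  rw [hdet]
  exact this

/-- A solution with coordinates in a local complex algebra with residue field `ℂ` has complex
coordinates. So the local rings of the complex scheme of solutions at its closed points are equal
to `ℂ`. -/
theorem IsGeneric.isSolution_eq_algebraMap [NeZero n] (hg : IsGeneric A B C D)
    (hD : ‖Matrix.toEuclideanCLM (𝕜 := ℝ) D‖ < 1)
    {L : Type*} [CommRing L] [Algebra ℂ L] [Algebra ℝ L] [IsScalarTower ℝ ℂ L]
    (ρ : L →ₐ[ℂ] ℂ) (hρ : ∀ a, ρ a ≠ 0 → IsUnit a) {y : PVar n m → L}
    (hy : IsSolution A B C D y) (a : PVar n m) : y a = algebraMap ℂ L (ρ (y a)) := by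
  classical
  have hp : IsSolution A B C D fun a => ρ (y a) := hy.map (ρ.restrictScalars ℝ)
  set p : PVar n m → ℂ := fun a => ρ (y a) with hpdef
  have map_smul_real : ∀ (r : ℝ) (z : L), ρ (r • z) = r • ρ z := fun r z =>
    map_smul (ρ.restrictScalars ℝ) r z
  have cancel : ∀ {s z : L}, ρ s ≠ 0 → s * z = 0 → z = 0 := fun hs h =>
    (hρ _ hs).mul_right_eq_zero.mp h
  set J : Finset (Fin m) := Finset.univ.filter fun j => p (.w j) ≠ 0 with hJ
  have hmemJ : ∀ j, j ∈ J ↔ p (.w j) ≠ 0 := by simp [hJ]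
  have hJ0 : ∀ j ∉ J, p (.w j) = 0 := fun j hj => by simpa [hmemJ] using hj
  have hJ1 : ∀ j ∈ J, p (.w j) = ∑ k, C j k • p (.x k) + ∑ k, D j k • p (.w k) := fun j hj =>
    (sub_eq_zero.mp ((mul_eq_zero.mp (hp.relu j)).resolve_left ((hmemJ j).mp hj))).symm
  obtain ⟨hv, hpw⟩ := hp.mem_unitEigenvectors hD hJ0 hJ1
  have hv0 : p (.x 0) ≠ 0 := hg.first_ne_zero' hv
  -- For `j ∉ J` the factor `C x + D w - w` cannot vanish at `p` in row `j`: otherwise `p` would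
  -- also come from `J ∪ {j}`, and the eigenvalue would be shared.
  have hyw0 : ∀ j ∉ J, y (.w j) = 0 := by
    intro j hj
    refine cancel (s := ∑ k, C j k • y (.x k) + ∑ k, D j k • y (.w k) - y (.w j)) ?_
      (by rw [mul_comm]; exact hy.relu j)
    intro h
    simp only [map_sub, map_add, map_sum, map_smul_real, sub_eq_zero] at h
    have hins := hp.mem_unitEigenvectors hD (J := insert j J)
      (fun k hk => hJ0 k fun h => hk (Finset.mem_insert_of_mem h))
      (fun k hk => by
        rcases Finset.mem_insert.mp hk with rfl | hk
        · exact h.symm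
        · exact hJ1 k hk)
    have := hg.eq_of_mem (mem_modeEigenvalues_of_mem hv) (mem_modeEigenvalues_of_mem hins.1)
    exact hj (this ▸ Finset.mem_insert_self j J)
  have hyw1 : ∀ j ∈ J, y (.w j) = ∑ k, C j k • y (.x k) + ∑ k, D j k • y (.w k) := fun j hj =>
    (sub_eq_zero.mp (cancel ((hmemJ j).mp hj) (hy.relu j))).symm
  have hw : ∀ j, y (.w j) = ∑ k, (activeInv D J * C) j k • y (.x k) := by
    intro j
    exact ((active_iff (isUnit_one_sub_submatrix hD J) (fun j => ∑ k, C j k • y (.x k))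
      (fun j => y (.w j))).mp ⟨hyw1, hyw0⟩ j).trans
        (sum_activeInv_smul_sum J (fun k => y (.x k)) j)
  have hx : ∀ i, ∑ k, realMode A B C D J i k • y (.x k) = y .lam * y (.x i) := fun i =>
    (sum_add_sum_eq_realMode (x := fun k => y (.x k)) J hw i).symm.trans (hy.linear i)
  -- The characteristic polynomial of `A_J` vanishes at `λ`, and it has simple roots.
  have hlam : y .lam = algebraMap ℂ L (p .lam) := by
    have h0 := aeval_charpoly_mul_eq_zero (realMode A B C D J) hx 0
    rw [mul_comm] at h0
    have h1 := cancel hv0 h0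
    rw [← Polynomial.aeval_map_algebraMap ℂ, ← charpoly_modeMatrix, hg.charpoly_eq_prod J,
      map_prod] at h1
    have hmem : p .lam ∈ (hg.finite_modeEigenvalues J).toFinset := by
      simpa using mem_modeEigenvalues_of_mem hv
    rw [← Finset.mul_prod_erase _ _ hmem, mul_comm] at h1
    have h2 := cancel (by
      rw [map_prod, Finset.prod_ne_zero_iff]
      intro μ hμ
      have : p .lam - μ ≠ 0 := sub_ne_zero.mpr (Finset.ne_of_mem_erase hμ).symm
      simpa using this) h1
    simpa [sub_eq_zero] using h2
  -- As the eigenspace is a line, the ratios of the coordinates are those of `p`.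
  have hxi : ∀ i, y (.x i) = algebraMap ℂ L (p (.x i) / p (.x 0)) * y (.x 0) := by
    intro i
    obtain ⟨c, hc⟩ := hg.exists_row_combination hv i
    set E : Matrix (Fin n) (Fin n) ℂ := modeMatrix A B C D J - p .lam • 1
    have hM : ∀ j, ∑ k, algebraMap ℂ L (E j k) * y (.x k)
        = 0 := by
      intro j
      have h1 : ∀ k, algebraMap ℂ L (E j k) * y (.x k) =
          realMode A B C D J j k • y (.x k) -
            algebraMap ℂ L (p .lam * (1 : Matrix (Fin n) (Fin n) ℂ) j k) * y (.x k) := by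
        intro k
        rw [Algebra.smul_def (realMode A B C D J j k) (y (.x k)),
          IsScalarTower.algebraMap_apply ℝ ℂ L, ← sub_mul, ← map_sub]
        rfl
      rw [Finset.sum_congr rfl fun k _ => h1 k, Finset.sum_sub_distrib, hx, hlam]
      simp [Matrix.one_apply, apply_ite (algebraMap ℂ L)]
    have h0 : ∑ j, algebraMap ℂ L (c j) *
        ∑ k, algebraMap ℂ L (E j k) * y (.x k) = 0 := by
      exact Finset.sum_eq_zero fun j _ => by rw [hM, mul_zero]
    simp only [Finset.mul_sum, ← mul_assoc, ← map_mul] at h0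
    rw [Finset.sum_comm] at h0
    simp only [← Finset.sum_mul, ← map_sum, hc] at h0
    simp only [map_sub, map_mul, sub_mul, Finset.sum_sub_distrib, mul_assoc] at h0
    rw [← Finset.mul_sum] at h0
    rw [← sub_eq_zero]
    simpa [Matrix.one_apply, apply_ite (algebraMap ℂ L)] using h0
  have hwj : ∀ j, y (.w j) = algebraMap ℂ L (p (.w j) / p (.x 0)) * y (.x 0) := by
    intro j
    rw [hw, hpw, Finset.sum_div, map_sum, Finset.sum_mul]
    refine Finset.sum_congr rfl fun k _ => ?_
    rw [hxi k, Algebra.smul_def, IsScalarTower.algebraMap_apply ℝ ℂ L, ← mul_assoc, ← map_mul,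
      Complex.real_smul, mul_div_assoc]
    rfl
  -- The normalization gives `y_1 ^ 2 = p_1 ^ 2`, and `y_1 + p_1` is a unit.
  have hx0 : y (.x 0) = algebraMap ℂ L (p (.x 0)) := by
    have hsq : algebraMap ℂ L ((p (.x 0) ^ 2)⁻¹) * y (.x 0) ^ 2 = 1 := by
      have h1 : ∀ i, y (.x i) ^ 2 =
          algebraMap ℂ L (p (.x i) ^ 2 / p (.x 0) ^ 2) * y (.x 0) ^ 2 := fun i => by
        rw [hxi i, mul_pow, ← map_pow, div_pow]
      have h2 : ∀ j, y (.w j) ^ 2 =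
          algebraMap ℂ L (p (.w j) ^ 2 / p (.x 0) ^ 2) * y (.x 0) ^ 2 := fun j => by
        rw [hwj j, mul_pow, ← map_pow, div_pow]
      rw [← hy.unit, Finset.sum_congr rfl fun i _ => h1 i, Finset.sum_congr rfl fun j _ => h2 j,
        ← Finset.sum_mul, ← Finset.sum_mul, ← add_mul, ← map_sum, ← map_sum, ← map_add,
        ← Finset.sum_div, ← Finset.sum_div, ← add_div, hp.unit, one_div]
    have hsq' : (y (.x 0) + algebraMap ℂ L (p (.x 0))) *
        (y (.x 0) - algebraMap ℂ L (p (.x 0))) = 0 := by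
      have h1 : algebraMap ℂ L (p (.x 0) ^ 2) * algebraMap ℂ L ((p (.x 0) ^ 2)⁻¹) = 1 := by
        rw [← map_mul, mul_inv_cancel₀ (pow_ne_zero 2 hv0), map_one]
      rw [map_pow] at h1
      linear_combination algebraMap ℂ L (p (.x 0)) ^ 2 * hsq - y (.x 0) ^ 2 * h1
    refine sub_eq_zero.mp (cancel ?_ hsq')
    have : p (.x 0) + p (.x 0) ≠ 0 := by simpa [← two_mul] using hv0
    simpa only [map_add, AlgHom.commutes, Algebra.algebraMap_self, RingHom.id_apply] using this
  cases a with
  | lam => exact hlam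
  | x i =>
    change y (.x i) = algebraMap ℂ L (p (.x i))
    rw [hxi i, hx0, ← map_mul, div_mul_cancel₀ _ hv0]
  | w j =>
    change y (.w j) = algebraMap ℂ L (p (.w j))
    rw [hwj j, hx0, ← map_mul, div_mul_cancel₀ _ hv0]

end Rigidity

/-! ### Extension of scalars from real to complex polynomials -/

section Descent

variable {σ : Type*}

theorem exists_eq_map_add_I_mul_map (h : MvPolynomial σ ℂ) :
    ∃ u v : MvPolynomial σ ℝ, h = MvPolynomial.map (algebraMap ℝ ℂ) u +
      MvPolynomial.C Complex.I * MvPolynomial.map (algebraMap ℝ ℂ) v := by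
  induction h using MvPolynomial.induction_on with
  | C z =>
    refine ⟨MvPolynomial.C z.re, MvPolynomial.C z.im, ?_⟩
    rw [MvPolynomial.map_C, MvPolynomial.map_C, ← map_mul, ← map_add]
    congr 1
    rw [mul_comm]
    exact (Complex.re_add_im z).symm
  | add p q hp hq =>
    obtain ⟨u, v, rfl⟩ := hp
    obtain ⟨u', v', rfl⟩ := hq
    exact ⟨u + u', v + v', by simp only [map_add]; ring⟩
  | mul_X p i hp =>
    obtain ⟨u, v, rfl⟩ := hp
    exact ⟨u * MvPolynomial.X i, v * MvPolynomial.X i, by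
      simp only [map_mul, MvPolynomial.map_X]; ring⟩

/-- The ideal generated by a real ideal `I` in the complex polynomials is `I + i I`. -/
theorem exists_of_mem_map_complex {I : Ideal (MvPolynomial σ ℝ)} {h : MvPolynomial σ ℂ}
    (hh : h ∈ I.map (MvPolynomial.map (algebraMap ℝ ℂ))) :
    ∃ u ∈ I, ∃ v ∈ I, h = MvPolynomial.map (algebraMap ℝ ℂ) u +
      MvPolynomial.C Complex.I * MvPolynomial.map (algebraMap ℝ ℂ) v := by
  have hI : (MvPolynomial.C Complex.I * MvPolynomial.C Complex.I : MvPolynomial σ ℂ) = -1 := by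
    rw [← map_mul, Complex.I_mul_I, map_neg, map_one]
  refine Submodule.span_induction ?_ ?_ ?_ ?_ hh
  · rintro _ ⟨f, hf, rfl⟩
    exact ⟨f, hf, 0, I.zero_mem, by simp⟩
  · exact ⟨0, I.zero_mem, 0, I.zero_mem, by simp⟩
  · rintro _ _ - - ⟨u, hu, v, hv, rfl⟩ ⟨u', hu', v', hv', rfl⟩
    exact ⟨u + u', I.add_mem hu hu', v + v', I.add_mem hv hv', by simp only [map_add]; ring⟩
  · rintro c _ - ⟨u, hu, v, hv, rfl⟩
    obtain ⟨a, b, rfl⟩ := exists_eq_map_add_I_mul_map c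
    refine ⟨a * u - b * v, I.sub_mem (I.mul_mem_left _ hu) (I.mul_mem_left _ hv),
      a * v + b * u, I.add_mem (I.mul_mem_left _ hv) (I.mul_mem_left _ hu), ?_⟩
    simp only [map_add, map_sub, map_mul, smul_eq_mul]
    linear_combination (MvPolynomial.map (algebraMap ℝ ℂ) b *
      MvPolynomial.map (algebraMap ℝ ℂ) v) * hI

theorem mem_of_map_mem_map_complex {I : Ideal (MvPolynomial σ ℝ)} {f : MvPolynomial σ ℝ}
    (hf : MvPolynomial.map (algebraMap ℝ ℂ) f ∈ I.map (MvPolynomial.map (algebraMap ℝ ℂ))) :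
    f ∈ I := by
  obtain ⟨u, hu, v, -, h⟩ := exists_of_mem_map_complex hf
  suffices f = u from this ▸ hu
  ext a
  have := congrArg Complex.re (congrArg (MvPolynomial.coeff a) h)
  simpa [MvPolynomial.coeff_map] using this

end Descent

/-! ### The ideal consists of all polynomials that vanish on the variety -/

section Radical

variable {A : Matrix (Fin n) (Fin n) ℝ} {B : Matrix (Fin n) (Fin m) ℝ}
  {C : Matrix (Fin m) (Fin n) ℝ} {D : Matrix (Fin m) (Fin m) ℝ}

/-- If `g` vanishes on the variety, the colon ideal of `g` is contained in no maximal ideal: at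
a point of the variety `g` becomes zero in the local ring, since that ring is `ℂ`. -/
theorem IsGeneric.mem_map_of_forall_aeval_eq_zero [NeZero n] (hg : IsGeneric A B C D)
    (hD : ‖Matrix.toEuclideanCLM (𝕜 := ℝ) D‖ < 1) {g : MvPolynomial (PVar n m) ℂ}
    (h : ∀ p : PVar n m → ℂ, IsSolution A B C D p → MvPolynomial.aeval p g = 0) :
    g ∈ (systemIdeal A B C D).map (MvPolynomial.map (algebraMap ℝ ℂ)) := by
  set I := (systemIdeal A B C D).map (MvPolynomial.map (algebraMap ℝ ℂ)) with hI
  let K : Ideal (MvPolynomial (PVar n m) ℂ) :=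
    Submodule.comap (LinearMap.toSpanSingleton (MvPolynomial (PVar n m) ℂ) _ g) I
  have hK : ∀ s, s ∈ K ↔ s * g ∈ I := fun s => Iff.rfl
  by_contra hgI
  have hKtop : K ≠ ⊤ := by
    rw [Ideal.ne_top_iff_one, hK, one_mul]
    exact hgI
  obtain ⟨M, hM, hKM⟩ := Ideal.exists_le_maximal K hKtop
  obtain ⟨p, rfl⟩ := MvPolynomial.isMaximal_iff_eq_vanishingIdeal_singleton.mp hM
  have hIp : ∀ f ∈ I, MvPolynomial.aeval p f = 0 := fun f hf =>
    (MvPolynomial.mem_vanishingIdeal_singleton_iff p f).mp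
      (hKM ((hK f).mpr (I.mul_mem_right g hf)))
  have hp : IsSolution A B C D p := by
    rw [isSolution_iff]
    intro f hf
    rw [← MvPolynomial.aeval_map_algebraMap ℂ]
    exact hIp _ (Ideal.mem_map_of_mem _ hf)
  let ev : (MvPolynomial (PVar n m) ℂ ⧸ I) →ₐ[ℂ] ℂ :=
    Ideal.Quotient.liftₐ I (MvPolynomial.aeval p) hIp
  have hev : ∀ f, ev (Ideal.Quotient.mk I f) = MvPolynomial.aeval p f := fun f => rfl
  let S : Submonoid (MvPolynomial (PVar n m) ℂ ⧸ I) := (nonZeroDivisors ℂ).comap ev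
  have hS : ∀ s, s ∈ S ↔ ev s ≠ 0 := fun s => mem_nonZeroDivisors_iff_ne_zero
  let ρ : Localization S →ₐ[ℂ] ℂ :=
    IsLocalization.liftAlgHom (M := S) (S := Localization S) (f := ev)
      fun s => ((hS s).mp s.2).isUnit
  have hρ : ∀ q, ρ (algebraMap _ (Localization S) q) = ev q := fun q =>
    IsLocalization.lift_eq _ q
  have hunit : ∀ a, ρ a ≠ 0 → IsUnit a := by
    intro a ha
    obtain ⟨⟨q, s⟩, hqs⟩ := IsLocalization.surj S a
    have hq : q ∈ S := by
      rw [hS, ← hρ, ← hqs, map_mul, hρ]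
      exact mul_ne_zero ha ((hS _).mp s.2)
    exact isUnit_of_mul_isUnit_left (hqs ▸ IsLocalization.map_units (Localization S) ⟨q, hq⟩)
  let φ : MvPolynomial (PVar n m) ℂ →ₐ[ℂ] Localization S :=
    (Algebra.algHom ℂ (MvPolynomial (PVar n m) ℂ ⧸ I) (Localization S)).comp
      (Ideal.Quotient.mkₐ ℂ I)
  have hφ : ∀ f, φ f = algebraMap _ (Localization S) (Ideal.Quotient.mk I f) := fun f => rfl
  have haev : MvPolynomial.aeval (fun a => φ (MvPolynomial.X a)) = φ :=
    MvPolynomial.algHom_ext fun a => MvPolynomial.aeval_X _ _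
  have hy : IsSolution A B C D fun a => φ (MvPolynomial.X a) := by
    rw [isSolution_iff]
    intro f hf
    rw [← MvPolynomial.aeval_map_algebraMap ℂ, haev, hφ,
      Ideal.Quotient.eq_zero_iff_mem.mpr (Ideal.mem_map_of_mem _ hf), map_zero]
  have hconst : φ = (Algebra.ofId ℂ (Localization S)).comp (MvPolynomial.aeval p) := by
    refine MvPolynomial.algHom_ext fun a => ?_
    rw [hg.isSolution_eq_algebraMap hD ρ hunit hy a, hφ, hρ, hev]
    rfl
  have hg0 : algebraMap _ (Localization S) (Ideal.Quotient.mk I g) = 0 := by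
    rw [← hφ, hconst, AlgHom.comp_apply, h p hp, map_zero]
  obtain ⟨⟨s, hs⟩, hsg⟩ := (IsLocalization.map_eq_zero_iff S (Localization S) _).mp hg0
  obtain ⟨t, rfl⟩ := Ideal.Quotient.mk_surjective s
  rw [← map_mul, Ideal.Quotient.eq_zero_iff_mem] at hsg
  exact (hS _).mp hs ((MvPolynomial.mem_vanishingIdeal_singleton_iff p t).mp
    (hKM ((hK t).mpr hsg)))

theorem IsGeneric.mem_systemIdeal_iff [NeZero n] (hg : IsGeneric A B C D)
    (hD : ‖Matrix.toEuclideanCLM (𝕜 := ℝ) D‖ < 1) {f : Poly n m} :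
    f ∈ systemIdeal A B C D ↔
      ∀ p : PVar n m → ℂ, IsSolution A B C D p → MvPolynomial.aeval p f = 0 := by
  refine ⟨fun hf p hp => (isSolution_iff p).mp hp f hf, fun h => ?_⟩
  refine mem_of_map_mem_map_complex (hg.mem_map_of_forall_aeval_eq_zero hD fun p hp => ?_)
  rw [MvPolynomial.aeval_map_algebraMap]
  exact h p hp

theorem IsGeneric.isRadical_systemIdeal [NeZero n] (hg : IsGeneric A B C D)
    (hD : ‖Matrix.toEuclideanCLM (𝕜 := ℝ) D‖ < 1) : (systemIdeal A B C D).IsRadical := by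
  rintro f ⟨k, hk⟩
  rw [hg.mem_systemIdeal_iff hD] at hk ⊢
  intro p hp
  have := hk p hp
  rw [map_pow] at this
  exact eq_zero_of_pow_eq_zero this

end Radical

/-! ### Real interpolation -/

/-- The interpolation polynomial of data that are compatible with complex conjugation is fixed by
conjugation, hence real. -/
theorem exists_real_interpolant {T : Finset ℂ} (hT : ∀ t ∈ T, (starRingEnd ℂ) t ∈ T)
    {r : ℂ → ℂ} (hr : ∀ t ∈ T, r ((starRingEnd ℂ) t) = (starRingEnd ℂ) (r t)) :
    ∃ u : Polynomial ℝ, u.degree < T.card ∧ ∀ t ∈ T, Polynomial.aeval t u = r t := by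
  classical
  set P := Lagrange.interpolate T id r
  have hdeg : P.degree < T.card := Lagrange.degree_interpolate_lt r Function.injective_id.injOn
  have heval : ∀ t ∈ T, P.eval t = r t := fun t ht =>
    Lagrange.eval_interpolate_at_node r Function.injective_id.injOn ht
  have hconj : P.map (starRingEnd ℂ) = P := by
    refine Polynomial.eq_of_degrees_lt_of_eval_finset_eq T
      (Polynomial.degree_map_le.trans_lt hdeg) hdeg fun t ht => ?_
    have h := Polynomial.eval_map_apply (p := P) (starRingEnd ℂ) ((starRingEnd ℂ) t)
    rw [Complex.conj_conj] at h
    rw [h, heval _ (hT t ht), hr t ht, Complex.conj_conj, heval t ht]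
  have hlift : P ∈ Polynomial.lifts (algebraMap ℝ ℂ) := by
    rw [Polynomial.lifts_iff_coeff_lifts]
    intro k
    have h := congrArg (fun q => Polynomial.coeff q k) hconj
    simp only [Polynomial.coeff_map] at h
    obtain ⟨c, hc⟩ := Complex.conj_eq_iff_real.mp h
    exact ⟨c, hc.symm⟩
  obtain ⟨u, hu⟩ := (Polynomial.lifts_iff_set_range _).mp hlift
  refine ⟨u, ?_, fun t ht => ?_⟩
  · rwa [← Polynomial.degree_map u (algebraMap ℝ ℂ), hu]
  · rw [← heval t ht, ← hu, Polynomial.eval_map_algebraMap]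

/-! ### The geometry of the variety -/

section Variety

variable {A : Matrix (Fin n) (Fin n) ℝ} {B : Matrix (Fin n) (Fin m) ℝ}
  {C : Matrix (Fin m) (Fin n) ℝ} {D : Matrix (Fin m) (Fin m) ℝ}

theorem IsSolution.conj {p : PVar n m → ℂ} (hp : IsSolution A B C D p) :
    IsSolution A B C D fun a => (starRingEnd ℂ) (p a) :=
  hp.map Complex.conjAe.toAlgHom

theorem IsSolution.exists_lam_mem (hD : ‖Matrix.toEuclideanCLM (𝕜 := ℝ) D‖ < 1)
    {p : PVar n m → ℂ} (hp : IsSolution A B C D p) :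
    ∃ J, p .lam ∈ modeEigenvalues A B C D J := by
  obtain ⟨J, hJ, -⟩ := hp.exists_mode hD
  exact ⟨J, mem_modeEigenvalues_of_mem hJ⟩

theorem IsGeneric.x_zero_ne_zero [NeZero n] (hg : IsGeneric A B C D)
    (hD : ‖Matrix.toEuclideanCLM (𝕜 := ℝ) D‖ < 1) {p : PVar n m → ℂ}
    (hp : IsSolution A B C D p) : p (.x 0) ≠ 0 := by
  obtain ⟨J, hJ, -⟩ := hp.exists_mode hD
  exact hg.first_ne_zero' hJ

/-- The fibres of the variety over the `λ`-axis are pairs of opposite points. -/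
theorem IsGeneric.eq_or_eq_neg_of_lam_eq [NeZero n] (hg : IsGeneric A B C D)
    (hD : ‖Matrix.toEuclideanCLM (𝕜 := ℝ) D‖ < 1) {p q : PVar n m → ℂ}
    (hp : IsSolution A B C D p) (hq : IsSolution A B C D q) (h : p .lam = q .lam) :
    (∀ a, a ≠ .lam → p a = q a) ∨ ∀ a, a ≠ .lam → p a = -q a := by
  obtain ⟨J, hJ, hpw⟩ := hp.exists_mode hD
  obtain ⟨K, hK, hqw⟩ := hq.exists_mode hD
  obtain rfl := hg.eq_of_mem (h ▸ mem_modeEigenvalues_of_mem hJ) (mem_modeEigenvalues_of_mem hK)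
  rw [← h] at hK
  refine (hg.eq_or_eq_neg hJ hK).imp (fun h a ha => ?_) fun h a ha => ?_
  · have hx : ∀ i, p (.x i) = q (.x i) := congrFun h
    cases a with
    | lam => exact absurd rfl ha
    | x i => exact hx i
    | w j => simp only [hpw, hqw, hx]
  · have hx : ∀ i, p (.x i) = -q (.x i) := congrFun h
    cases a with
    | lam => exact absurd rfl ha
    | x i => exact hx i
    | w j => simp only [hpw, hqw, hx, smul_neg, Finset.sum_neg_distrib]

theorem IsGeneric.finite_iUnion [NeZero n] (hg : IsGeneric A B C D) :
    (⋃ J, modeEigenvalues A B C D J).Finite :=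
  Set.finite_iUnion hg.finite_modeEigenvalues

/-- All eigenvalues of all the matrices `A_J`. -/
noncomputable def IsGeneric.nodes [NeZero n] (hg : IsGeneric A B C D) : Finset ℂ :=
  hg.finite_iUnion.toFinset

theorem IsGeneric.card_nodes [NeZero n] (hg : IsGeneric A B C D) : hg.nodes.card = n * 2 ^ m := by
  rw [← hg.ncard_iUnion, Set.ncard_eq_toFinset_card _ hg.finite_iUnion]
  rfl

theorem IsGeneric.mem_nodes [NeZero n] (hg : IsGeneric A B C D) {t : ℂ} :
    t ∈ hg.nodes ↔ ∃ J, t ∈ modeEigenvalues A B C D J := by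
  simp [IsGeneric.nodes]

/-- Over each eigenvalue there are two points of the variety, with opposite first coordinates. -/
theorem IsGeneric.exists_isSolution_pair [NeZero n] (hg : IsGeneric A B C D)
    (hD : ‖Matrix.toEuclideanCLM (𝕜 := ℝ) D‖ < 1) {t : ℂ} (ht : t ∈ hg.nodes) :
    ∃ p q : PVar n m → ℂ, IsSolution A B C D p ∧ IsSolution A B C D q ∧ p .lam = t ∧
      q .lam = t ∧ q (.x 0) = -p (.x 0) := by
  obtain ⟨J, hJ⟩ := hg.mem_nodes.mp ht
  obtain ⟨v, hv⟩ := Set.nonempty_of_ncard_ne_zero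
    (show (unitEigenvectors A B C D J t).ncard ≠ 0 by
      rw [hg.ncard_unitEigenvectors J t hJ]; exact two_ne_zero)
  exact ⟨_, _, isSolution_modePoint hD hv, isSolution_modePoint hD (neg_mem_unitEigenvectors hv),
    rfl, rfl, rfl⟩

/-- A function on the variety that is compatible with conjugation and constant on the fibres
over the `λ`-axis is a real polynomial in `λ`. -/
theorem IsGeneric.exists_polynomial_in_lam [NeZero n] (hg : IsGeneric A B C D)
    (hD : ‖Matrix.toEuclideanCLM (𝕜 := ℝ) D‖ < 1) (c : (PVar n m → ℂ) → ℂ)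
    (hconj : ∀ p, c (fun a => (starRingEnd ℂ) (p a)) = (starRingEnd ℂ) (c p))
    (hfib : ∀ p q, IsSolution A B C D p → IsSolution A B C D q → p .lam = q .lam → c p = c q) :
    ∃ u : Polynomial ℝ, u.degree < (n * 2 ^ m : ℕ) ∧
      ∀ p, IsSolution A B C D p → Polynomial.aeval (p .lam) u = c p := by
  have hmem : ∀ p, IsSolution A B C D p → p .lam ∈ hg.nodes := fun p hp =>
    hg.mem_nodes.mpr (hp.exists_lam_mem hD)
  have hex : ∀ t, ∃ p, t ∈ hg.nodes → IsSolution A B C D p ∧ p .lam = t := by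
    intro t
    by_cases ht : t ∈ hg.nodes
    · obtain ⟨p, -, hp, -, hpt, -, -⟩ := hg.exists_isSolution_pair hD ht
      exact ⟨p, fun _ => ⟨hp, hpt⟩⟩
    · exact ⟨0, fun h => absurd h ht⟩
  choose P hP using hex
  have hT : ∀ t ∈ hg.nodes, (starRingEnd ℂ) t ∈ hg.nodes := by
    intro t ht
    have := hmem _ (hP t ht).1.conj
    rwa [(hP t ht).2] at this
  obtain ⟨u, hu, hev⟩ := exists_real_interpolant hT (r := fun t => c (P t)) fun t ht => by
    rw [← hconj]
    refine hfib _ _ (hP _ (hT t ht)).1 (hP t ht).1.conj ?_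
    rw [(hP _ (hT t ht)).2, (hP t ht).2]
  refine ⟨u, by rwa [hg.card_nodes] at hu, fun p hp => ?_⟩
  rw [hev _ (hmem p hp)]
  exact hfib _ _ (hP _ (hmem p hp)).1 hp (hP _ (hmem p hp)).2

/-- The projection of a point of the variety that forgets `λ`. -/
def forgetLam (p : PVar n m → ℂ) : Fin n ⊕ Fin m → ℂ :=
  Sum.elim (fun i => p (.x i)) fun j => p (.w j)

theorem image_forgetLam (hD : ‖Matrix.toEuclideanCLM (𝕜 := ℝ) D‖ < 1) :
    forgetLam '' MvPolynomial.zeroLocus ℂ (systemIdeal A B C D) =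
      stackedEigenvectors A B C D := by
  ext y
  constructor
  · rintro ⟨p, hp, rfl⟩
    obtain ⟨J, hJ, hw⟩ := (mem_zeroLocus_iff_isSolution.mp hp).exists_mode hD
    convert stack_mem_stackedEigenvectors hJ using 1
    funext k
    rcases k with i | j
    · rfl
    · rw [stack_inr, ← hw]
      rfl
  · intro hy
    obtain ⟨J, v, hv, rfl⟩ := Set.mem_iUnion.mp hy
    obtain ⟨μ, -, hv⟩ := Set.mem_iUnion₂.mp hv
    refine ⟨modePoint C D J μ v, mem_zeroLocus_iff_isSolution.mpr (isSolution_modePoint hD hv), ?_⟩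
    funext k
    rcases k with i | j
    · rfl
    · rw [stack_inr]
      rfl

theorem IsGeneric.injOn_forgetLam [NeZero n] (hg : IsGeneric A B C D)
    (hD : ‖Matrix.toEuclideanCLM (𝕜 := ℝ) D‖ < 1) :
    Set.InjOn forgetLam (MvPolynomial.zeroLocus ℂ (systemIdeal A B C D)) := by
  intro p hp q hq h
  rw [mem_zeroLocus_iff_isSolution] at hp hq
  have hx : ∀ i, p (.x i) = q (.x i) := fun i => congrFun h (Sum.inl i)
  have hw : ∀ j, p (.w j) = q (.w j) := fun j => congrFun h (Sum.inr j)
  have hlam : p .lam = q .lam := by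
    have h1 := hp.linear 0
    simp only [hx, hw] at h1
    rw [hq.linear 0] at h1
    exact (mul_right_cancel₀ (hg.x_zero_ne_zero hD hq) h1).symm
  funext a
  cases a with
  | lam => exact hlam
  | x i => exact hx i
  | w j => exact hw j

theorem mul_two_pow_pos (n m : ℕ) [NeZero n] : 0 < n * 2 ^ m :=
  Nat.mul_pos (NeZero.pos n) (Nat.two_pow_pos m)

theorem IsGeneric.finite_zeroLocus [NeZero n] (hg : IsGeneric A B C D)
    (hD : ‖Matrix.toEuclideanCLM (𝕜 := ℝ) D‖ < 1) :
    (MvPolynomial.zeroLocus ℂ (systemIdeal A B C D)).Finite := by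
  refine Set.Finite.of_finite_image ?_ (hg.injOn_forgetLam hD)
  rw [image_forgetLam hD]
  refine Set.finite_of_ncard_ne_zero ?_
  rw [hg.ncard_stacked]
  have := mul_two_pow_pos n m
  omega

theorem IsGeneric.ncard_zeroLocus [NeZero n] (hg : IsGeneric A B C D)
    (hD : ‖Matrix.toEuclideanCLM (𝕜 := ℝ) D‖ < 1) :
    (MvPolynomial.zeroLocus ℂ (systemIdeal A B C D)).ncard = 2 * (n * 2 ^ m) := by
  rw [← (hg.injOn_forgetLam hD).ncard_image, image_forgetLam hD, hg.ncard_stacked]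

/-- A polynomial `P(λ) x_1 + Q(λ)` that vanishes on the variety has `P = 0` as soon as
`deg P < N`, because each fibre over the `λ`-axis contains two opposite points. -/
theorem IsGeneric.left_eq_zero_of_vanish [NeZero n] (hg : IsGeneric A B C D)
    (hD : ‖Matrix.toEuclideanCLM (𝕜 := ℝ) D‖ < 1) {P Q : Polynomial ℝ}
    (hP : P.degree < (n * 2 ^ m : ℕ))
    (h : ∀ p : PVar n m → ℂ, IsSolution A B C D p →
      Polynomial.aeval (p .lam) P * p (.x 0) + Polynomial.aeval (p .lam) Q = 0) : P = 0 := by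
  rw [← Polynomial.map_eq_zero_iff (algebraMap ℝ ℂ).injective]
  refine Polynomial.eq_zero_of_degree_lt_of_eval_finset_eq_zero hg.nodes ?_ fun t ht => ?_
  · rwa [Polynomial.degree_map, hg.card_nodes]
  · obtain ⟨p, q, hp, hq, rfl, hqt, hx⟩ := hg.exists_isSolution_pair hD ht
    have h1 := h p hp
    have h2 := h q hq
    rw [hqt, hx] at h2
    rw [Polynomial.eval_map_algebraMap]
    have h3 : Polynomial.aeval (p .lam) P * (2 * p (.x 0)) = 0 := by linear_combination h1 - h2
    exact (mul_eq_zero.mp h3).resolve_right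
      (mul_ne_zero two_ne_zero (hg.x_zero_ne_zero hD hp))

theorem IsGeneric.eq_zero_of_vanish [NeZero n] (hg : IsGeneric A B C D)
    (hD : ‖Matrix.toEuclideanCLM (𝕜 := ℝ) D‖ < 1) {Q : Polynomial ℝ}
    (hQ : Q.degree < (n * 2 ^ m : ℕ))
    (h : ∀ p : PVar n m → ℂ, IsSolution A B C D p → Polynomial.aeval (p .lam) Q = 0) : Q = 0 :=
  hg.left_eq_zero_of_vanish hD (Q := 0) hQ fun p hp => by rw [h p hp]; simp

/-- The product of the characteristic polynomials of all the matrices `A_J`. -/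
noncomputable def eliminant (A : Matrix (Fin n) (Fin n) ℝ) (B : Matrix (Fin n) (Fin m) ℝ)
    (C : Matrix (Fin m) (Fin n) ℝ) (D : Matrix (Fin m) (Fin m) ℝ) : Polynomial ℝ :=
  ∏ J : Finset (Fin m), (realMode A B C D J).charpoly

theorem monic_eliminant : (eliminant A B C D).Monic :=
  Polynomial.monic_prod_of_monic _ _ fun _ _ => Matrix.charpoly_monic _

theorem natDegree_eliminant : (eliminant A B C D).natDegree = n * 2 ^ m := by
  rw [eliminant, Polynomial.natDegree_prod_of_monic _ _ fun _ _ => Matrix.charpoly_monic _]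
  simp [Matrix.charpoly_natDegree_eq_dim, mul_comm]

theorem IsSolution.aeval_eliminant (hD : ‖Matrix.toEuclideanCLM (𝕜 := ℝ) D‖ < 1)
    {p : PVar n m → ℂ} (hp : IsSolution A B C D p) :
    Polynomial.aeval (p .lam) (eliminant A B C D) = 0 := by
  obtain ⟨J, hJ⟩ := hp.exists_lam_mem hD
  rw [mem_modeEigenvalues_iff_isRoot, charpoly_modeMatrix, Polynomial.IsRoot,
    Polynomial.eval_map_algebraMap] at hJ
  rw [eliminant, map_prod]
  exact Finset.prod_eq_zero (Finset.mem_univ J) hJ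

end Variety

/-! ### Standard monomials and the lexicographic order -/

section Shape

theorem PVar.le_iff {a b : PVar n m} : a ≤ b ↔ a.pos ≤ b.pos := Iff.rfl

theorem PVar.le_lam (a : PVar n m) : a ≤ .lam := PVar.le_iff.mpr a.pos_le

theorem inLam_monomial (k : ℕ) (c : ℝ) : (inLam (Polynomial.monomial k c) : Poly n m) =
    MvPolynomial.monomial (Finsupp.single .lam k) c := by
  rw [inLam, Polynomial.aeval_monomial, MvPolynomial.X_pow_eq_monomial,
    MvPolynomial.algebraMap_eq, MvPolynomial.C_mul_monomial, mul_one]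

theorem inLam_eq_sum (q : Polynomial ℝ) :
    (inLam q : Poly n m) = ∑ k ∈ q.support,
      MvPolynomial.monomial (Finsupp.single .lam k) (q.coeff k) := by
  conv_lhs => rw [q.as_sum_support, inLam, map_sum]
  exact Finset.sum_congr rfl fun k _ => inLam_monomial k _

theorem aeval_inLam {L : Type*} [CommRing L] [Algebra ℝ L] (p : PVar n m → L)
    (q : Polynomial ℝ) :
    MvPolynomial.aeval p (inLam q : Poly n m) = Polynomial.aeval (p .lam) q := by
  rw [inLam, ← Polynomial.aeval_algHom_apply, MvPolynomial.aeval_X]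

theorem exists_of_mem_support_inLam {q : Polynomial ℝ} {a : PVar n m →₀ ℕ}
    (ha : a ∈ (inLam q : Poly n m).support) : ∃ k, q.coeff k ≠ 0 ∧ a = Finsupp.single .lam k := by
  classical
  rw [inLam_eq_sum] at ha
  obtain ⟨k, hk, hak⟩ := Finset.mem_biUnion.mp (MvPolynomial.support_sum ha)
  refine ⟨k, Polynomial.mem_support_iff.mp hk, ?_⟩
  exact Finset.mem_singleton.mp (MvPolynomial.support_monomial_subset hak)

theorem exists_of_mem_support_inLam_mul {q : Polynomial ℝ} {y : PVar n m} {a : PVar n m →₀ ℕ}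
    (ha : a ∈ (inLam q * MvPolynomial.X y : Poly n m).support) :
    ∃ k, q.coeff k ≠ 0 ∧ a = Finsupp.single .lam k + Finsupp.single y 1 := by
  classical
  rw [MvPolynomial.support_mul_X, Finset.mem_map] at ha
  obtain ⟨b, hb, rfl⟩ := ha
  obtain ⟨k, hk, rfl⟩ := exists_of_mem_support_inLam hb
  exact ⟨k, hk, rfl⟩

variable [NeZero n]

theorem PVar.le_x_zero {a : PVar n m} (ha : a ≠ .lam) : a ≤ .x 0 := by
  rw [PVar.le_iff]
  rcases a with _ | ⟨i, hi⟩ | ⟨i, hi⟩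
  · exact absurd rfl ha
  all_goals simp only [PVar.pos, Fin.val_zero]; omega

/-- The exponent `d` such that `y ^ d` is the leading monomial of the basis element that belongs
to the variable `y`. -/
def leadExp (n m : ℕ) [NeZero n] : PVar n m → ℕ
  | .lam => n * 2 ^ m
  | .x i => if i = 0 then 2 else 1
  | .w _ => 1

theorem leadExp_pos (y : PVar n m) : 0 < leadExp n m y := by
  rcases y with _ | i | j
  · exact mul_two_pow_pos n m
  · simp only [leadExp]; split_ifs <;> omega
  · exact one_pos

theorem leadExp_eq_one {y : PVar n m} (h1 : y ≠ .lam) (h2 : y ≠ .x 0) : leadExp n m y = 1 := by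
  rcases y with _ | i | j
  · exact absurd rfl h1
  · have : i ≠ 0 := fun h => h2 (h ▸ rfl)
    simp [leadExp, this]
  · rfl

/-- The leading monomial of the basis element that belongs to the variable `y`. -/
noncomputable def leadMon (y : PVar n m) : PVar n m →₀ ℕ := Finsupp.single y (leadExp n m y)

/-- Standard monomials: those divisible by no leading monomial of the basis. They are
`λ ^ k` and `λ ^ k x_1` with `k < N`. -/
def IsStandard (a : PVar n m →₀ ℕ) : Prop := ∀ y, a y < leadExp n m y

theorem isStandard_iff {a : PVar n m →₀ ℕ} : IsStandard a ↔ ∀ y, ¬ leadMon y ≤ a := by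
  simp [IsStandard, leadMon]

theorem IsStandard.eq_zero {a : PVar n m →₀ ℕ} (ha : IsStandard a) {y : PVar n m}
    (h1 : y ≠ .lam) (h2 : y ≠ .x 0) : a y = 0 := by
  have := ha y
  rw [leadExp_eq_one h1 h2] at this
  omega

theorem isStandard_of {a : PVar n m →₀ ℕ} (h : ∀ y, y ≠ .lam → y ≠ .x 0 → a y = 0)
    (hx : a (.x 0) ≤ 1) (hl : a .lam < n * 2 ^ m) : IsStandard a := by
  intro y
  by_cases h1 : y = .lam
  · exact h1 ▸ hl
  by_cases h2 : y = .x 0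
  · subst h2
    simp only [leadExp]
    simpa using Nat.lt_succ_of_le hx
  · rw [h y h1 h2]
    exact leadExp_pos y

theorem IsStandard.lt_leadMon {a : PVar n m →₀ ℕ} (ha : IsStandard a) {y : PVar n m}
    (h : ∀ z, a z ≠ 0 → y ≤ z) : a ≺[lexOrder n m] leadMon y := by
  rw [MonomialOrder.lex_lt_iff]
  refine ⟨y, fun z hz => ?_, ?_⟩
  · have h0 : a z = 0 := by
      by_contra h0
      exact absurd (h z h0) (not_le.mpr hz)
    have hne : y ≠ z := hz.ne'
    simp [leadMon, h0, hne]
  · simpa [leadMon] using ha y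

/-- If the monomial `a` is standard, then a lexicographically smaller monomial involves no
variable besides `λ` and `x_1`, has at most the same degree in `x_1`, and if that degree is the
same, has at most the same degree in `λ`. -/
theorem IsStandard.of_le {a b : PVar n m →₀ ℕ} (ha : IsStandard a)
    (hba : b ≼[lexOrder n m] a) :
    (∀ y, y ≠ .lam → y ≠ .x 0 → b y = 0) ∧
      (b (.x 0) < a (.x 0) ∨ b (.x 0) = a (.x 0) ∧ b .lam ≤ a .lam) := by
  rw [MonomialOrder.lex_le_iff] at hba
  rcases hba.eq_or_lt with h | h
  · have h : b = a := h
    subst h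
    exact ⟨fun y h1 h2 => ha.eq_zero h1 h2, Or.inr ⟨rfl, le_rfl⟩⟩
  · obtain ⟨y, hlt, hy⟩ := h
    have hlt : ∀ z, z < y → b z = a z := hlt
    have hy : b y < a y := hy
    by_cases h1 : y = .lam
    · subst h1
      have heq : ∀ z, z ≠ .lam → b z = a z := fun z hz => hlt z (lt_of_le_of_ne z.le_lam hz)
      exact ⟨fun z hz hz' => (heq z hz).trans (ha.eq_zero hz hz'),
        Or.inr ⟨heq _ (by simp), hy.le⟩⟩
    · by_cases h2 : y = .x 0
      · subst h2
        exact ⟨fun z hz hz' => (hlt z (lt_of_le_of_ne (PVar.le_x_zero hz) hz')).trans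
          (ha.eq_zero hz hz'), Or.inl hy⟩
      · rw [ha.eq_zero h1 h2] at hy
        omega

/-! ### The basis elements -/

/-- The element of the set `shapeSet u₀ u v` that belongs to a variable. -/
noncomputable def shapePoly (u₀ : Polynomial ℝ) (u : Fin n → Polynomial ℝ)
    (v : Fin m → Polynomial ℝ) : PVar n m → Poly n m
  | .lam => inLam u₀
  | .x i => if i = 0 then MvPolynomial.X (.x 0) ^ 2 - inLam (u 0)
      else MvPolynomial.X (.x i) - inLam (u i) * MvPolynomial.X (.x 0)
  | .w j => MvPolynomial.X (.w j) - inLam (v j) * MvPolynomial.X (.x 0)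

theorem range_shapePoly (u₀ : Polynomial ℝ) (u : Fin n → Polynomial ℝ)
    (v : Fin m → Polynomial ℝ) : Set.range (shapePoly u₀ u v) = shapeSet u₀ u v := by
  ext f
  constructor
  · rintro ⟨_ | i | j, rfl⟩
    · exact Or.inl (Or.inl (Or.inl rfl))
    · by_cases hi : i = 0
      · exact Or.inl (Or.inl (Or.inr (by simp [shapePoly, hi])))
      · exact Or.inl (Or.inr ⟨i, hi, by simp [shapePoly, hi]⟩)
    · exact Or.inr ⟨j, rfl⟩
  · rintro (((rfl | rfl) | ⟨i, hi, rfl⟩) | ⟨j, rfl⟩)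
    · exact ⟨.lam, rfl⟩
    · exact ⟨.x 0, by simp [shapePoly]⟩
    · exact ⟨.x i, by simp [shapePoly, hi]⟩
    · exact ⟨.w j, rfl⟩

theorem lt_of_coeff_ne_zero {q : Polynomial ℝ} {N k : ℕ} (hq : q.degree < N)
    (hk : q.coeff k ≠ 0) : k < N := by
  by_contra h
  exact hk (Polynomial.coeff_eq_zero_of_degree_lt (hq.trans_le (by exact_mod_cast not_lt.mp h)))

theorem isStandard_single_lam {k : ℕ} (hk : k < n * 2 ^ m) :
    IsStandard (Finsupp.single .lam k : PVar n m →₀ ℕ) :=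
  isStandard_of (fun y h1 _ => by simp [Ne.symm h1]) (by simp) (by simpa using hk)

theorem isStandard_single_lam_add {k : ℕ} (hk : k < n * 2 ^ m) :
    IsStandard (Finsupp.single .lam k + Finsupp.single (.x 0) 1 : PVar n m →₀ ℕ) :=
  isStandard_of (fun y h1 h2 => by simp [Ne.symm h1, Ne.symm h2]) (by simp) (by simpa using hk)

/-- A basis element is its leading monomial plus a combination of smaller standard monomials. -/
theorem shapePoly_eq {u₀ : Polynomial ℝ} {u : Fin n → Polynomial ℝ} {v : Fin m → Polynomial ℝ}
    (hu₀ : u₀.Monic) (hN : u₀.natDegree = n * 2 ^ m) (hu : ∀ i, (u i).degree < (n * 2 ^ m : ℕ))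
    (hv : ∀ j, (v j).degree < (n * 2 ^ m : ℕ)) (y : PVar n m) :
    ∃ r : Poly n m, shapePoly u₀ u v y = MvPolynomial.monomial (leadMon y) 1 + r ∧
      ∀ a ∈ r.support, IsStandard a ∧ a ≺[lexOrder n m] leadMon y := by
  have step : ∀ (r : Poly n m), (∀ a ∈ r.support, IsStandard a ∧ ∀ z, a z ≠ 0 → y ≤ z) →
      ∀ a ∈ r.support, IsStandard a ∧ a ≺[lexOrder n m] leadMon y := fun r h a ha =>
    ⟨(h a ha).1, (h a ha).1.lt_leadMon (h a ha).2⟩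
  -- The remainders `-u_i x_1` and `-v_j x_1`.
  have tail : y ≠ .lam → ∀ q : Polynomial ℝ, q.degree < (n * 2 ^ m : ℕ) →
      ∀ a ∈ (-(inLam q * MvPolynomial.X (.x 0)) : Poly n m).support,
        IsStandard a ∧ ∀ z, a z ≠ 0 → y ≤ z := by
    intro hy q hq a ha
    rw [MvPolynomial.support_neg] at ha
    obtain ⟨k, hk, rfl⟩ := exists_of_mem_support_inLam_mul ha
    refine ⟨isStandard_single_lam_add (lt_of_coeff_ne_zero hq hk), fun z hz => ?_⟩
    by_cases h1 : z = .lam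
    · exact h1 ▸ y.le_lam
    by_cases h2 : z = .x 0
    · exact h2 ▸ PVar.le_x_zero hy
    · simp [Ne.symm h1, Ne.symm h2] at hz
  have lamtail : ∀ q : Polynomial ℝ, q.degree < (n * 2 ^ m : ℕ) →
      ∀ a ∈ (inLam q : Poly n m).support, IsStandard a ∧ ∀ z, a z ≠ 0 → y ≤ z := by
    intro q hq a ha
    obtain ⟨k, hk, rfl⟩ := exists_of_mem_support_inLam ha
    refine ⟨isStandard_single_lam (lt_of_coeff_ne_zero hq hk), fun z hz => ?_⟩
    by_cases h1 : z = .lam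
    · exact h1 ▸ y.le_lam
    · simp [Ne.symm h1] at hz
  rcases y with _ | i | j
  · refine ⟨inLam (u₀ - Polynomial.X ^ (n * 2 ^ m)), ?_, step _ (lamtail _ ?_)⟩
    · simp [shapePoly, inLam, leadMon, leadExp, MvPolynomial.X_pow_eq_monomial]
    · have h := Polynomial.degree_sub_lt_left (p := u₀) (q := Polynomial.X ^ (n * 2 ^ m))
        (by rw [Polynomial.degree_X_pow, Polynomial.degree_eq_natDegree hu₀.ne_zero, hN])
        hu₀.ne_zero (by simp [hu₀.leadingCoeff])
      rwa [Polynomial.degree_eq_natDegree hu₀.ne_zero, hN] at h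
  · by_cases hi : i = 0
    · subst hi
      refine ⟨-inLam (u 0), ?_, step _ fun a ha => lamtail _ (hu 0) a ?_⟩
      · simp [shapePoly, leadMon, leadExp, MvPolynomial.X_pow_eq_monomial, sub_eq_add_neg]
      · rwa [MvPolynomial.support_neg] at ha
    · refine ⟨_, ?_, step _ (tail (by simp) (u i) (hu i))⟩
      simp [shapePoly, leadMon, leadExp, hi, sub_eq_add_neg, MvPolynomial.X]
  · refine ⟨_, ?_, step _ (tail (by simp) (v j) (hv j))⟩
    simp [shapePoly, leadMon, leadExp, sub_eq_add_neg, MvPolynomial.X]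

/-! ### Reduced Gröbner bases of the given shape -/

theorem leading_of_eq {f r : Poly n m} {y : PVar n m}
    (hf : f = MvPolynomial.monomial (leadMon y) 1 + r)
    (hr : ∀ a ∈ r.support, a ≺[lexOrder n m] leadMon y) :
    (lexOrder n m).leadingCoeff f = 1 ∧
      (lexOrder n m).leadingTerm f = MvPolynomial.monomial (leadMon y) 1 := by
  classical
  have hdeg : (lexOrder n m).degree (MvPolynomial.monomial (leadMon y) (1 : ℝ)) = leadMon y := by
    rw [MonomialOrder.degree_monomial, if_neg one_ne_zero]
  have hpos : 0 ≺[lexOrder n m] leadMon y := by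
    rw [map_zero, MonomialOrder.toSyn_lt_iff_ne_zero, Ne, MonomialOrder.toSyn_eq_zero_iff]
    simpa [leadMon] using (leadExp_pos y).ne'
  have hlt : (lexOrder n m).degree r ≺[lexOrder n m]
      (lexOrder n m).degree (MvPolynomial.monomial (leadMon y) (1 : ℝ)) := by
    rw [hdeg, MonomialOrder.degree_lt_iff hpos]
    exact hr
  have hlc : (lexOrder n m).leadingCoeff f = 1 := by
    rw [hf, MonomialOrder.leadingCoeff_add_of_lt hlt, MonomialOrder.leadingCoeff_monomial]
  refine ⟨hlc, ?_⟩
  rw [MonomialOrder.leadingTerm, hlc, hf, MonomialOrder.degree_add_of_lt hlt, hdeg]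

/-- A polynomial in standard monomials has the form `P(λ) x_1 + Q(λ)`. -/
theorem exists_eq_inLam_mul_add {f : Poly n m} {N : ℕ}
    (h : ∀ b ∈ f.support, (∀ y, y ≠ .lam → y ≠ .x 0 → b y = 0) ∧ b (.x 0) ≤ 1)
    (hN : ∀ b ∈ f.support, b (.x 0) = 1 → b .lam < N) :
    ∃ P Q : Polynomial ℝ, P.degree < N ∧ f = inLam P * MvPolynomial.X (.x 0) + inLam Q ∧
      ((∀ b ∈ f.support, b .lam < N) → Q.degree < N) := by
  have hsum : ∀ (s : Finset (PVar n m →₀ ℕ)) (F : (PVar n m →₀ ℕ) → Polynomial ℝ),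
      (inLam (∑ b ∈ s, F b) : Poly n m) = ∑ b ∈ s, inLam (F b) := fun s F => map_sum _ _ _
  have hzero : (inLam 0 : Poly n m) = 0 := map_zero _
  refine ⟨∑ b ∈ f.support,
      if b (.x 0) = 1 then Polynomial.monomial (b .lam) (f.coeff b) else 0,
    ∑ b ∈ f.support, if b (.x 0) = 1 then 0 else Polynomial.monomial (b .lam) (f.coeff b),
    ?_, ?_, fun hN' => ?_⟩
  · rw [← Polynomial.mem_degreeLT]
    refine Submodule.sum_mem _ fun b hb => ?_
    split_ifs with h1
    · rw [Polynomial.mem_degreeLT]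
      exact (Polynomial.degree_monomial_le _ _).trans_lt (by exact_mod_cast hN b hb h1)
    · exact Submodule.zero_mem _
  · conv_lhs => rw [f.as_sum]
    rw [hsum, hsum, Finset.sum_mul, ← Finset.sum_add_distrib]
    refine Finset.sum_congr rfl fun b hb => ?_
    obtain ⟨h0, hx⟩ := h b hb
    split_ifs with h1
    · rw [hzero, add_zero, inLam_monomial, MvPolynomial.X, MvPolynomial.monomial_mul, mul_one]
      refine congrArg (fun s => MvPolynomial.monomial s (f.coeff b)) (Finsupp.ext fun z => ?_)
      by_cases hz1 : z = .lam
      · subst hz1; simp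
      by_cases hz2 : z = .x 0
      · subst hz2; simp [h1]
      · simp [h0 z hz1 hz2, Ne.symm hz1, Ne.symm hz2]
    · rw [hzero, zero_mul, zero_add, inLam_monomial]
      refine congrArg (fun s => MvPolynomial.monomial s (f.coeff b)) (Finsupp.ext fun z => ?_)
      by_cases hz1 : z = .lam
      · subst hz1; simp
      by_cases hz2 : z = .x 0
      · subst hz2
        have : b (.x 0) = 0 := by omega
        simp [this]
      · simp [h0 z hz1 hz2, Ne.symm hz1]
  · rw [← Polynomial.mem_degreeLT]
    refine Submodule.sum_mem _ fun b hb => ?_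
    split_ifs with h1
    · exact Submodule.zero_mem _
    · rw [Polynomial.mem_degreeLT]
      exact (Polynomial.degree_monomial_le _ _).trans_lt (by exact_mod_cast hN' b hb)

variable {A : Matrix (Fin n) (Fin n) ℝ} {B : Matrix (Fin n) (Fin m) ℝ}
  {C : Matrix (Fin m) (Fin n) ℝ} {D : Matrix (Fin m) (Fin m) ℝ}

/-- No nonzero element of the ideal has a standard leading monomial, because the standard
monomials are linearly independent as functions on the variety. -/
theorem IsGeneric.not_isStandard_degree (hg : IsGeneric A B C D)
    (hD : ‖Matrix.toEuclideanCLM (𝕜 := ℝ) D‖ < 1) {f : Poly n m}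
    (hf : f ∈ systemIdeal A B C D) (hf0 : f ≠ 0) : ¬ IsStandard ((lexOrder n m).degree f) := by
  intro ha
  set a := (lexOrder n m).degree f with hadef
  have hb := fun b hb => ha.of_le ((lexOrder n m).le_degree (f := f) (d := b) hb)
  have hax : a (.x 0) ≤ 1 := by
    have := ha (.x 0)
    simp only [leadExp, if_true] at this
    omega
  have hal : a .lam < n * 2 ^ m := ha .lam
  obtain ⟨P, Q, hP, hPQ, hQ⟩ := exists_eq_inLam_mul_add (f := f) (N := n * 2 ^ m)
    (fun b hbs => ⟨(hb b hbs).1, by rcases (hb b hbs).2 with h | h <;> omega⟩)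
    (fun b hbs h1 => by rcases (hb b hbs).2 with h | h <;> omega)
  have hvan : ∀ p : PVar n m → ℂ, IsSolution A B C D p →
      Polynomial.aeval (p .lam) P * p (.x 0) + Polynomial.aeval (p .lam) Q = 0 := by
    intro p hp
    have := (hg.mem_systemIdeal_iff hD).mp hf p hp
    rwa [hPQ, map_add, map_mul, aeval_inLam, aeval_inLam, MvPolynomial.aeval_X] at this
  obtain rfl := hg.left_eq_zero_of_vanish hD hP hvan
  have hfQ : f = inLam Q := by
    rw [hPQ, inLam, map_zero, zero_mul, zero_add]
  have hx0 : ∀ b ∈ f.support, b (.x 0) = 0 := by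
    intro b hbs
    rw [hfQ] at hbs
    obtain ⟨k, -, rfl⟩ := exists_of_mem_support_inLam hbs
    simp
  have hax0 := hx0 a (MonomialOrder.degree_mem_support hf0)
  have hQ0 := hg.eq_zero_of_vanish hD
    (hQ fun b hbs => by rcases (hb b hbs).2 with h | h <;> omega)
    (fun p hp => by simpa using hvan p hp)
  apply hf0
  rw [hfQ, hQ0, inLam, map_zero]

theorem IsGeneric.isReducedGroebnerBasis_shapeSet (hg : IsGeneric A B C D)
    (hD : ‖Matrix.toEuclideanCLM (𝕜 := ℝ) D‖ < 1) {u₀ : Polynomial ℝ}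
    {u : Fin n → Polynomial ℝ} {v : Fin m → Polynomial ℝ}
    (hu₀ : u₀.Monic) (hN : u₀.natDegree = n * 2 ^ m) (hu : ∀ i, (u i).degree < (n * 2 ^ m : ℕ))
    (hv : ∀ j, (v j).degree < (n * 2 ^ m : ℕ))
    (hmem : ∀ y, shapePoly u₀ u v y ∈ systemIdeal A B C D) :
    IsReducedGroebnerBasis (lexOrder n m) (systemIdeal A B C D) (shapeSet u₀ u v) := by
  choose r hr hrs using shapePoly_eq hu₀ hN hu hv
  have hlead := fun y => leading_of_eq (hr y) fun a ha => (hrs y a ha).2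
  rw [← range_shapePoly]
  refine ⟨⟨Set.finite_range _, ?_, fun f hf hf0 => ?_⟩, ?_, ?_⟩
  · rintro _ ⟨y, rfl⟩
    exact hmem y
  · have hns := hg.not_isStandard_degree hD hf hf0
    rw [isStandard_iff] at hns
    push Not at hns
    obtain ⟨y, hy⟩ := hns
    refine ⟨_, ⟨y, rfl⟩, ?_⟩
    rw [(hlead y).2, MonomialOrder.leadingTerm, MvPolynomial.monomial_dvd_monomial]
    exact ⟨Or.inr hy, one_dvd _⟩
  · rintro _ ⟨y, rfl⟩
    exact (hlead y).1
  · rintro _ ⟨y, rfl⟩ a ha hspan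
    have hsub : (lexOrder n m).leadingTerm '' (Set.range (shapePoly u₀ u v) \ {shapePoly u₀ u v y})
        ⊆ (fun s => MvPolynomial.monomial s (1 : ℝ)) '' (leadMon '' {z | z ≠ y}) := by
      rintro _ ⟨_, ⟨⟨z, rfl⟩, hz⟩, rfl⟩
      refine ⟨leadMon z, ⟨z, ?_, rfl⟩, (hlead z).2.symm⟩
      rintro rfl
      exact hz rfl
    have hspan' := Ideal.span_mono hsub hspan
    rw [MvPolynomial.mem_ideal_span_monomial_image] at hspan'
    obtain ⟨_, ⟨z, hz, rfl⟩, hle⟩ := hspan' a (by simp)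
    classical
    rw [hr y] at ha
    rcases Finset.mem_union.mp (MvPolynomial.support_add ha) with ha | ha
    · obtain rfl := Finset.mem_singleton.mp (MvPolynomial.support_monomial_subset ha)
      have h1 := hle z
      have hz' : y ≠ z := Ne.symm hz
      simp only [leadMon, Finsupp.single_eq_same, Finsupp.single_apply, if_neg hz'] at h1
      exact absurd h1 (not_le.mpr (leadExp_pos z))
    · exact isStandard_iff.mp (hrs y a ha).1 z hle

/-- On the variety `x_1 ^ 2`, `x_i / x_1` and `w_j / x_1` depend on `λ` only. -/
theorem IsGeneric.exists_isReducedGroebnerBasis (hg : IsGeneric A B C D)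
    (hD : ‖Matrix.toEuclideanCLM (𝕜 := ℝ) D‖ < 1) :
    ∃ (u₀ : Polynomial ℝ) (u : Fin n → Polynomial ℝ) (v : Fin m → Polynomial ℝ),
      IsReducedGroebnerBasis (lexOrder n m) (systemIdeal A B C D) (shapeSet u₀ u v) ∧
      u₀.natDegree = n * 2 ^ m := by
  obtain ⟨s, hs, hsev⟩ := hg.exists_polynomial_in_lam hD (fun p => p (.x 0) ^ 2) (by simp) (by
    intro p q hp hq h
    rcases hg.eq_or_eq_neg_of_lam_eq hD hp hq h with h | h <;> simp [h (.x 0) (by simp)])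
  have hratio : ∀ a : PVar n m, a ≠ .lam → ∃ c : Polynomial ℝ, c.degree < (n * 2 ^ m : ℕ) ∧
      ∀ p : PVar n m → ℂ, IsSolution A B C D p → Polynomial.aeval (p .lam) c = p a / p (.x 0) := by
    intro a ha
    refine hg.exists_polynomial_in_lam hD (fun p => p a / p (.x 0)) (by simp) ?_
    intro p q hp hq h
    rcases hg.eq_or_eq_neg_of_lam_eq hD hp hq h with h | h <;>
      simp [h (.x 0) (by simp), h a ha]
  choose u hu huev using fun i : Fin n => hratio (.x i) (by simp)
  choose v hv hvev using fun j : Fin m => hratio (.w j) (by simp)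
  refine ⟨eliminant A B C D, fun i => if i = 0 then s else u i, v,
    hg.isReducedGroebnerBasis_shapeSet hD monic_eliminant natDegree_eliminant ?_ hv ?_,
    natDegree_eliminant⟩
  · intro i
    split_ifs
    · exact hs
    · exact hu i
  · intro y
    rw [hg.mem_systemIdeal_iff hD]
    intro p hp
    have hx := hg.x_zero_ne_zero hD hp
    rcases y with _ | i | j
    · rw [shapePoly, aeval_inLam, hp.aeval_eliminant hD]
    · by_cases hi : i = 0
      · simp [shapePoly, hi, aeval_inLam, hsev p hp]
      · simp [shapePoly, hi, aeval_inLam, huev i p hp, hx]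
    · simp [shapePoly, aeval_inLam, hvev j p hp, hx]

end Shape

end ReLU

theorem mainTheorem7 (n m : ℕ) [NeZero n]
    (A : Matrix (Fin n) (Fin n) ℝ) (B : Matrix (Fin n) (Fin m) ℝ)
    (C : Matrix (Fin m) (Fin n) ℝ) (D : Matrix (Fin m) (Fin m) ℝ)
    (hD : ‖Matrix.toEuclideanCLM (𝕜 := ℝ) D‖ < 1)
    (hgen : ReLU.IsGeneric A B C D) :
    (MvPolynomial.zeroLocus ℂ (ReLU.systemIdeal A B C D)).Finite ∧
    (ReLU.systemIdeal A B C D).IsRadical ∧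
    ∃ (u₀ : Polynomial ℝ) (u : Fin n → Polynomial ℝ) (v : Fin m → Polynomial ℝ),
      ReLU.IsReducedGroebnerBasis (ReLU.lexOrder n m) (ReLU.systemIdeal A B C D)
        (ReLU.shapeSet u₀ u v) ∧
      2 * u₀.natDegree = (MvPolynomial.zeroLocus ℂ (ReLU.systemIdeal A B C D)).ncard ∧
      u₀.natDegree = n * 2 ^ m := by
  obtain ⟨u₀, u, v, hG, hN⟩ := hgen.exists_isReducedGroebnerBasis hD
  refine ⟨hgen.finite_zeroLocus hD, hgen.isRadical_systemIdeal hD, u₀, u, v, hG, ?_, hN⟩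
  rw [hN, hgen.ncard_zeroLocus hD]
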